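/- **Setting.** Let $(\lambda_n)_{n\ge1}$ be positive reals (scaling factors) and $(w_n)_{n\ge1}$ non-negative reals with $w_1>0$ (weights), and put $W_n=\sum_{k=1}^n w_k$. Let $(\mathsf B,\mathsf D,\rho,\nu)$ be a random compact pointed metric space endowed with a Borel probability measure $\nu$ (the block), and let $(\mathsf B_n,\mathsf D_n,\rho_n,\nu_n)_{n\ge1}$ be i.i.d. copies of it; as usual, they are realised as random compact subsets of a Polish metric space $(U,\delta)$ that contain a fixed point $u_0=\rho_n$ and carry $\nu_n$, measurably for the Hausdorff–Prokhorov distance. Conditionally on the blocks, let $(K_n,X_n)_{n\ge1}$ be independent, where $K_n=k$ with probability $w_k/W_n$ for $1\le k\le n$ and, given $K_n=k$, $X_n\in\mathsf B_k$ has law $\nu_k$. Let $\mathbf b_n=(\mathsf B_n,\lambda_n\mathsf D_n)$. Start from $\mathcal T_1=\mathbf b_1$ and, for $n\ge1$, obtain $\mathcal T_{n+1}$ from $\mathcal T_n$ by identifying the root of $\mathbf b_{n+1}$ with the point $X_n$ of the block $\mathbf b_{K_n}\subset\mathcal T_n$ (each distance in the glued space being the sum of the distances travelled in the blocks). Let $\mathcal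 T^*=\bigcup_{n\ge1}\mathcal T_n$, let $\mathcal T$ be its completion and let $\mathcal L=\mathcal T\setminus\mathcal T^*$ be the set of leaves. **Hypothesis $\diamond_{\alpha,\beta}$.** $\alpha>0$, $\beta>1$; as $n\to\infty$, $\lambda_n\le n^{-\alpha+o(1)}$ and $w_n\le n^{-\beta+o(1)}$; and for every $\epsilon>0$, $$\#\{k\in\{n,\dots,2n\}:\ w_k\ge n^{-\beta-\epsilon},\ \lambda_k\ge n^{-\alpha-\epsilon}\}=n^{1+o(1)}\quad\text{as } n\to\infty .$$ **Hypothesis $H_d$** ($d\ge0$). 1. If $d=0$: almost surely $\mathsf B$ is finite and $\nu(\{x\})>0$ for all $x\in\mathsf B$, and $\mathsf B$ is not almost surely reduced to a single point. If $d>0$: there is a non-decreasing $\varphi:[0,1]\to[0,d/2]$ with $\lim_{r\to0}\varphi(r)=0$ such that almost surely there is a (random) $r_0\in(0,1)$ with $r^{d+\varphi(r)}\le\nu(B(x,r))\le r^{d-\varphi(r)}$ for all $r\in[0,r_0)$ and $x\in\mathsf B$, where $B(x,r)$ is the open ball. 2. If $N_r(\mathsf B)$ denotes the minimal number of balls of radius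 $r$ needed to cover $\mathsf B$, then $\mathbb E[N_r(\mathsf B)]\le r^{-d+o(1)}$ as $r\to0$. 3. $\mathbb E[\operatorname{diam}(\mathsf B)^k]<\infty$ for all integers $k\ge0$. **Proposition.** Suppose that $(\lambda_n)$ and $(w_n)$ satisfy Hypothesis $\diamond_{\alpha,\beta}$ and that the law of the block satisfies Hypothesis $H_d$ for some $d\ge0$. Then almost surely $$\dim_{\mathrm H}(\mathcal L)\ \ge\ \frac{2\beta-1-2\sqrt{(\beta-1)(\beta-\alpha d)}}{\alpha}\quad\text{if }\alpha<\tfrac1d,\qquad\qquad \dim_{\mathrm H}(\mathcal L)\ \ge\ \frac1\alpha\quad\text{otherwise},$$ where $\frac1d=\infty$ if $d=0$. -/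

import Mathlib

open MeasureTheory ProbabilityTheory Filter Topology
open scoped ENNReal

namespace Gluing

/-! ### Blocks

A block is a compact pointed metric space with a probability measure, realised inside a Polish
metric space `U` with its root at the base point `u₀`. The topology is that of the
Hausdorff-Prokhorov distance: Hausdorff distance for the compact set, weak convergence for the
measure. -/

section Block

variable (U : Type*) [MetricSpace U] [MeasurableSpace U] [BorelSpace U]

/-- Pairs `(K, ν)` with `K ⊆ U` compact, `u₀ ∈ K`, and `ν` a probability measure carried by `K`. -/
def Block (u₀ : U) : Type _ :=
  {p : TopologicalSpace.NonemptyCompacts U × ProbabilityMeasure U //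
    u₀ ∈ p.1 ∧ (p.2 : Measure U) (p.1 : Set U)ᶜ = 0}

noncomputable instance (u₀ : U) : TopologicalSpace (Block U u₀) := instTopologicalSpaceSubtype

noncomputable instance (u₀ : U) : MeasurableSpace (Block U u₀) := borel _

instance (u₀ : U) : BorelSpace (Block U u₀) := ⟨rfl⟩

end Block

section BlockFunctions

variable {U : Type*} [MetricSpace U] [MeasurableSpace U] [BorelSpace U] {u₀ : U}

/-- The underlying compact set of a block. -/
def Block.carrier (b : Block U u₀) : Set U := (b.1.1 : Set U)

/-- The probability measure of a block. -/
def Block.meas (b : Block U u₀) : Measure U := (b.1.2 : Measure U)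

/-- The minimal number of open balls of radius `r`, centred in the block, that cover the block. -/
noncomputable def Block.coverNum (b : Block U u₀) (r : ℝ) : ℕ :=
  sInf {m : ℕ | ∃ s : Finset U, s.card = m ∧ (s : Set U) ⊆ b.carrier ∧
    b.carrier ⊆ ⋃ x ∈ s, Metric.ball x r}

/-- The `d`-dimensional control of the mass of the balls of the block, up to radius `r₀`. -/
def Block.BallControl (b : Block U u₀) (d : ℝ) (φ : ℝ → ℝ) (r₀ : ℝ) : Prop :=
  ∀ r ∈ Set.Ico 0 r₀, ∀ x ∈ b.carrier,
    r ^ (d + φ r) ≤ b.meas.real (Metric.ball x r) ∧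
      b.meas.real (Metric.ball x r) ≤ r ^ (d - φ r)

/-- Hypothesis `H_d` on the law `τ` of the block. -/
structure HypH (d : ℝ) (τ : Measure (Block U u₀)) : Prop where
  finite_of_eq_zero : d = 0 →
    (∀ᵐ b ∂τ, b.carrier.Finite ∧ ∀ x ∈ b.carrier, 0 < b.meas {x}) ∧
      ¬ ∀ᵐ b ∂τ, b.carrier = {u₀}
  ball_of_pos : 0 < d → ∃ φ : ℝ → ℝ,
    MonotoneOn φ (Set.Icc 0 1) ∧ Set.MapsTo φ (Set.Icc 0 1) (Set.Icc 0 (d / 2)) ∧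
      Tendsto φ (𝓝[>] 0) (𝓝 0) ∧
      ∀ᵐ b ∂τ, ∃ r₀ ∈ Set.Ioo (0 : ℝ) 1, b.BallControl d φ r₀
  cover : ∃ o : ℝ → ℝ, Tendsto o (𝓝[>] 0) (𝓝 0) ∧
    ∀ᶠ r in 𝓝[>] (0 : ℝ),
      ∫⁻ b, (b.coverNum r : ℝ≥0∞) ∂τ ≤ ENNReal.ofReal (r ^ (-d + o r))
  diam_moment : ∀ k : ℕ, ∫⁻ b, Metric.ediam b.carrier ^ k ∂τ < ∞

end BlockFunctions

/-! ### Scaling factors and weights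

Sequences are indexed by `n ≥ 1`; their value at `0` plays no role. -/

/-- `G_n^ε`: the indices `k` in `{n, …, 2n}` with `w k ≥ n ^ (-β - ε)` and
`lam k ≥ n ^ (-α - ε)`. -/
noncomputable def goodIndices (α β : ℝ) (lam w : ℕ → ℝ) (ε : ℝ) (n : ℕ) : Finset ℕ :=
  open Classical in
  (Finset.Icc n (2 * n)).filter fun k =>
    (n : ℝ) ^ (-β - ε) ≤ w k ∧ (n : ℝ) ^ (-α - ε) ≤ lam k

/-- Hypothesis `◇_{α,β}` on the scaling factors `lam` and the weights `w`. -/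
structure HypDiamond (α β : ℝ) (lam w : ℕ → ℝ) : Prop where
  alpha_pos : 0 < α
  one_lt_beta : 1 < β
  lam_le : ∃ o : ℕ → ℝ, Tendsto o atTop (𝓝 0) ∧ ∀ᶠ n : ℕ in atTop, lam n ≤ (n : ℝ) ^ (-α + o n)
  w_le : ∃ o : ℕ → ℝ, Tendsto o atTop (𝓝 0) ∧ ∀ᶠ n : ℕ in atTop, w n ≤ (n : ℝ) ^ (-β + o n)
  card_good : ∀ ε > 0, ∃ o : ℕ → ℝ, Tendsto o atTop (𝓝 0) ∧
    ∀ᶠ n : ℕ in atTop, ((goodIndices α β lam w ε n).card : ℝ) = (n : ℝ) ^ (1 + o n)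

/-- `W_n = w_1 + ⋯ + w_n`. -/
def totalWeight (w : ℕ → ℝ) (n : ℕ) : ℝ := ∑ k ∈ Finset.Icc 1 n, w k

/-! ### The ambient space

Sequences `x` in `U` with `∑ lam n * dist (x n) u₀ < ∞`, with the distance
`∑ lam n * dist (x n) (y n)`: the factor `lam n` dilates the distances of the `n`-th block. -/

section Ambient

variable {U : Type*} [MetricSpace U]

/-- The weighted `ℓ¹` space over `(U, u₀)`. -/
@[ext]
structure Ambient (u₀ : U) (lam : ℕ → ℝ) (hlam : ∀ n, 0 < lam n) where
  /-- the coordinates -/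
  coord : ℕ → U
  summable_coord : Summable fun n => lam n * dist (coord n) u₀

variable {u₀ : U} {lam : ℕ → ℝ} {hlam : ∀ n, 0 < lam n}

theorem Ambient.summable_dist (x y : Ambient u₀ lam hlam) :
    Summable fun n => lam n * dist (x.coord n) (y.coord n) := by
  refine Summable.of_nonneg_of_le (fun n => mul_nonneg (hlam n).le dist_nonneg) (fun n => ?_)
    (x.summable_coord.add y.summable_coord)
  rw [← mul_add]
  exact mul_le_mul_of_nonneg_left (dist_triangle_right _ _ _) (hlam n).le

noncomputable instance : MetricSpace (Ambient u₀ lam hlam) where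
  dist x y := ∑' n, lam n * dist (x.coord n) (y.coord n)
  dist_self x := by simp
  dist_comm x y := by simp only [dist_comm]
  dist_triangle x y z := by
    rw [← (x.summable_dist y).tsum_add (y.summable_dist z)]
    refine (x.summable_dist z).tsum_le_tsum (fun n => ?_)
      ((x.summable_dist y).add (y.summable_dist z))
    rw [← mul_add]
    exact mul_le_mul_of_nonneg_left (dist_triangle _ _ _) (hlam n).le
  eq_of_dist_eq_zero := by
    intro x y h
    ext n
    have h0 : ∀ n, 0 ≤ lam n * dist (x.coord n) (y.coord n) :=
      fun n => mul_nonneg (hlam n).le dist_nonneg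
    have h1 := (hasSum_zero_iff_of_nonneg h0).1 (h ▸ (x.summable_dist y).hasSum)
    have h2 := congrFun h1 n
    exact dist_eq_zero.1 ((mul_eq_zero.1 h2).resolve_left (hlam n).ne')

/-- The constant sequence `(u₀, u₀, …)`. -/
def Ambient.base : Ambient u₀ lam hlam := ⟨fun _ => u₀, by simp [summable_zero]⟩

/-- Replace the `k`-th coordinate of `x` by `u`. -/
def Ambient.set (x : Ambient u₀ lam hlam) (k : ℕ) (u : U) : Ambient u₀ lam hlam where
  coord := Function.update x.coord k u
  summable_coord := by
    refine (summable_congr_cofinite ?_).2 x.summable_coord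
    refine (Set.finite_singleton k).subset (fun n hn => ?_)
    by_contra hne
    exact hn (by simp [Function.update_of_ne (show n ≠ k from hne)])

end Ambient

/-! ### The gluing construction

`K n` and `X n` (`n ≥ 1`) tell where block `n + 1` is grafted: at the point `X n` of block `K n`. -/

section Construction

variable {U : Type*} [MetricSpace U] {u₀ : U} {lam : ℕ → ℝ}

/-- The position of the root of the `n`-th block. For `n = 1` it is the base point; for `n + 1` it
is the point `X n` of block `K n` (the fallback is only reached when `1 ≤ K n ≤ n` fails, that is
for `n = 0` or on a null event). -/
def rootPos (hlam : ∀ n, 0 < lam n) (K : ℕ → ℕ) (X : ℕ → U) : ℕ → Ambient u₀ lam hlam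
  | 0 => Ambient.base
  | n + 1 =>
    if _h : 1 ≤ K n ∧ K n ≤ n then (rootPos hlam K X (K n)).set (K n) (X n) else Ambient.base
  termination_by n => n
  decreasing_by omega

variable [MeasurableSpace U] [BorelSpace U]

/-- The skeleton `𝒯*`: the union over `n ≥ 1` of the copies of the blocks `B n`, block `n` using the
`n`-th coordinate. -/
def skeleton (hlam : ∀ n, 0 < lam n) (B : ℕ → Block U u₀) (K : ℕ → ℕ) (X : ℕ → U) :
    Set (Ambient u₀ lam hlam) :=
  ⋃ n ∈ Set.Ici 1, (rootPos hlam K X n).set n '' (B n).carrier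

/-- The structure `𝒯`, the closure (equivalently, completion) of the skeleton. -/
def structureT (hlam : ∀ n, 0 < lam n) (B : ℕ → Block U u₀) (K : ℕ → ℕ) (X : ℕ → U) :
    Set (Ambient u₀ lam hlam) :=
  closure (skeleton hlam B K X)

/-- The set of leaves `ℒ = 𝒯 \ 𝒯*`. -/
def leaves (hlam : ∀ n, 0 < lam n) (B : ℕ → Block U u₀) (K : ℕ → ℕ) (X : ℕ → U) :
    Set (Ambient u₀ lam hlam) :=
  structureT hlam B K X \ skeleton hlam B K X

/-- The law of `(K n, X n)` given the blocks: `K n = k` with probability `w k / W n`, and given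
`K n = k`, the point `X n` has law the probability measure of block `k`. -/
noncomputable def graftLaw (w : ℕ → ℝ) (B : ℕ → Block U u₀) (n : ℕ) : Measure (ℕ × U) :=
  ∑ k ∈ Finset.Icc 1 n,
    ENNReal.ofReal (w k / totalWeight w n) • (B k).meas.map (fun x => (k, x))

/-- The randomness of the construction: the blocks `B n`, `n ≥ 1`, are i.i.d. with law `τ` and,
conditionally on the sequence of blocks, the `(K n, X n)`, `n ≥ 1`, are independent with respective
laws `graftLaw w B n`. -/
structure IsGluingProcess {Ω : Type*} [MeasurableSpace Ω] (P : Measure Ω)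
    (τ : Measure (Block U u₀)) (w : ℕ → ℝ)
    (B : ℕ → Ω → Block U u₀) (K : ℕ → Ω → ℕ) (X : ℕ → Ω → U) : Prop where
  measurable_block : ∀ n ≥ 1, Measurable (B n)
  measurable_index : ∀ n ≥ 1, Measurable (K n)
  measurable_point : ∀ n ≥ 1, Measurable (X n)
  block_law : ∀ n ≥ 1, P.map (B n) = τ
  block_indep : iIndepFun (fun i : ℕ => B (i + 1)) P
  graft_law : ∀ (N : ℕ) (A : Set (ℕ → Block U u₀)) (C : ℕ → Set (ℕ × U)),
    MeasurableSet A → (∀ n, MeasurableSet (C n)) →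
      P {ω | (fun i => B (i + 1) ω) ∈ A ∧ ∀ n ∈ Finset.Icc 1 N, (K n ω, X n ω) ∈ C n} =
        ∫⁻ ω in {ω | (fun i => B (i + 1) ω) ∈ A},
          ∏ n ∈ Finset.Icc 1 N, graftLaw w (fun k => B k ω) n (C n) ∂P

end Construction

end Gluing

namespace Gluing

/-! ### Positions in the ambient space -/

section Position

variable {U : Type*} [MetricSpace U] {u₀ : U} {lam : ℕ → ℝ} {hlam : ∀ n, 0 < lam n}

/-! By the mass distribution principle it suffices to find, almost surely and for every `σ` below
the stated value, a probability measure on the leaves giving mass `O(r ^ σ)` to sets of small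
diameter `r`. The measure used is the law of the end of a uniform path in a regular tree of blocks
(`BlockTree.ofReal_le_dimH_leaves`).

The levels of the tree live at the scales `x_k = 2 ^ (γ ^ k)`: up to rounding and small losses `ε`,
a block of level `k` has index in `[x_k, 2 x_k]`, scaling factor at least `x_k ^ (-α)` and weight at
least `x_k ^ (-β)`. With probability bounded below it contains about `x_k ^ (s d)` disjoint cells of
radius `x_k ^ (-s)`, away from its root and of mass at least `x_k ^ (-s d)`; for `d = 0` a single
cell suffices (`HypH.exists_cells`). About `x_k ^ γ` good indices of the next level are cut into
`x_k ^ θ` disjoint groups, and each block is asked to receive a child from every group in every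
cell. Since the total weight is bounded, one index succeeds with probability at least of order `x_k
^ (-β - s d)`, so if `β + θ + s d < γ` a failure has probability at most `exp (-κ x_k ^ δ)` for some
`κ, δ > 0`. A union bound and Borel-Cantelli make every level succeed from some level on
(`IsGluingProcess.measure_badLevel_le`, `exists_blockTree`).

Two leaves that leave a common block of level `k` through different children are at distance at
least of order `x_(k+1) ^ (-α)`, and also at least `x_k ^ (-α)` times the distance of the two
grafting points. Hence a set of diameter `r` between these scales of levels `k + 1` and `k` only
sees the children of one block grafted in a small ball. If the number of paths down to level `k` is
at least of order `x_k ^ a`, the Frostman bound reduces to inequalities at the two endpoints of the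
range of `r` (`eventually_max_le`). Optimising `γ, s, θ, a` gives the two bounds
(`exists_exponents_of_lt_one`, `exists_exponents_of_one_le`). All inequalities are strict, which
absorbs the losses `ε` (`exists_perturbed_exponents`). -/

theorem Ambient.dist_eq (x y : Ambient u₀ lam hlam) :
    dist x y = ∑' n, lam n * dist (x.coord n) (y.coord n) := rfl

theorem Ambient.mul_dist_coord_le (x y : Ambient u₀ lam hlam) (n : ℕ) :
    lam n * dist (x.coord n) (y.coord n) ≤ dist x y :=
  (x.summable_dist y).le_tsum n fun m _ => mul_nonneg (hlam m).le dist_nonneg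

theorem Ambient.set_coord_self (x : Ambient u₀ lam hlam) (k : ℕ) :
    x.set k (x.coord k) = x := by
  ext n
  simp [Ambient.set]

variable (hlam) in
-- The path from the base point to the root of block `n` only travels in ancestors, whose indices
-- are smaller than `n`.
theorem rootPos_coord_of_le (K : ℕ → ℕ) (X : ℕ → U) (n : ℕ) :
    ∀ m, n ≤ m → (rootPos (u₀ := u₀) hlam K X n).coord m = u₀ := by
  induction n using Nat.strong_induction_on with
  | _ n ih =>
    intro m hm
    cases n with
    | zero => rw [rootPos]; rfl
    | succ n =>
      rw [rootPos]
      split_ifs with h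
      · have hne : m ≠ K n := by omega
        simp only [Ambient.set, Function.update_of_ne hne]
        exact ih (K n) (by omega) m (by omega)
      · rfl

theorem rootPos_coord_of_parent (K : ℕ → ℕ) (X : ℕ → U) {i j : ℕ} (hi : 1 ≤ i) (hij : i < j)
    (hK : K (j - 1) = i) (m : ℕ) :
    (rootPos (u₀ := u₀) hlam K X j).coord m =
      if m = i then X (j - 1) else (rootPos (u₀ := u₀) hlam K X i).coord m := by
  obtain ⟨n, rfl⟩ : ∃ n, j = n + 1 := ⟨j - 1, by omega⟩
  rw [Nat.add_sub_cancel] at hK ⊢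
  subst hK
  rw [rootPos, dif_pos ⟨hi, by omega⟩]
  simp only [Ambient.set, Function.update_apply]

variable [MeasurableSpace U]

theorem rootPos_mem_skeleton [BorelSpace U] (B : ℕ → Block U u₀) (K : ℕ → ℕ) (X : ℕ → U)
    {n : ℕ} (hn : 1 ≤ n) :
    rootPos hlam K X n ∈ skeleton hlam B K X := by
  refine Set.mem_iUnion₂.2 ⟨n, hn, u₀, (B n).2.1, ?_⟩
  have h := Ambient.set_coord_self (rootPos (u₀ := u₀) hlam K X n) n
  rwa [rootPos_coord_of_le hlam K X n n le_rfl] at h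

/-- Points of the skeleton have only finitely many nontrivial coordinates. -/
theorem coord_eq_of_mem_skeleton {B : ℕ → Block U u₀} {K : ℕ → ℕ} {X : ℕ → U}
    {x : Ambient u₀ lam hlam} (hx : x ∈ skeleton hlam B K X) :
    ∃ n, ∀ m, n < m → x.coord m = u₀ := by
  obtain ⟨n, -, u, -, rfl⟩ := Set.mem_iUnion₂.1 hx
  refine ⟨n, fun m hm => ?_⟩
  simp only [Ambient.set, Function.update_of_ne hm.ne']
  exact rootPos_coord_of_le hlam K X n m hm.le

end Position

/-! ### Trees of blocks -/

section Tree

variable {U : Type*} [MetricSpace U]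

/-- A regular tree of blocks: level `k` consists of indices in `nodes k`, and every block of level
`k` has `size k` distinct children in level `k + 1`, grafted at distance at least `c` from its root.
The number of children grafted in a closed ball of radius `ρ` is at most `cnt k ρ`. -/
structure BlockTree (u₀ : U) (lam : ℕ → ℝ) (K : ℕ → ℕ) (X : ℕ → U) (c : ℝ) (l b : ℕ → ℝ)
    (cnt : ℕ → ℝ → ℝ) where
  size : ℕ → ℕ
  size_pos : ∀ k, 0 < size k
  nodes : ℕ → Set ℕ
  root : ℕ
  child : (k : ℕ) → ℕ → Fin (size k) → ℕ
  root_mem : root ∈ nodes 0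
  child_mem : ∀ k, ∀ i ∈ nodes k, ∀ t, child k i t ∈ nodes (k + 1)
  one_le : ∀ k, ∀ i ∈ nodes k, 1 ≤ i
  lt_of_mem : ∀ k, ∀ i ∈ nodes k, ∀ j ∈ nodes (k + 1), i < j
  parent : ∀ k, ∀ i ∈ nodes k, ∀ t, K (child k i t - 1) = i
  far : ∀ k, ∀ i ∈ nodes k, ∀ t, c ≤ dist (X (child k i t - 1)) u₀
  bounded : ∀ k, ∀ i ∈ nodes k, ∀ t, lam i * dist (X (child k i t - 1)) u₀ ≤ b k
  injective : ∀ k, ∀ i ∈ nodes k, Function.Injective (child k i)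
  le_lam : ∀ k, ∀ i ∈ nodes k, l k ≤ lam i
  spread : ∀ k, ∀ i ∈ nodes k, ∀ z ρ,
    ((Finset.univ.filter fun t => dist (X (child k i t - 1)) z ≤ ρ).card : ℝ) ≤ cnt k ρ

namespace BlockTree

variable {u₀ : U} {lam : ℕ → ℝ} {K : ℕ → ℕ} {X : ℕ → U} {c : ℝ} {l b : ℕ → ℝ}
  {cnt : ℕ → ℝ → ℝ} (T : BlockTree u₀ lam K X c l b cnt)

/-- The block of level `k` on the path coded by `a`. -/
def node (a : (k : ℕ) → Fin (T.size k)) : ℕ → ℕ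
  | 0 => T.root
  | k + 1 => T.child k (node a k) (a k)

variable (a a' : (k : ℕ) → Fin (T.size k))

theorem node_mem (k : ℕ) : T.node a k ∈ T.nodes k := by
  induction k with
  | zero => exact T.root_mem
  | succ k ih => exact T.child_mem k _ ih _

theorem node_strictMono : StrictMono (T.node a) :=
  strictMono_nat_of_lt_succ fun k => T.lt_of_mem k _ (T.node_mem a k) _ (T.node_mem a (k + 1))

theorem one_le_node (k : ℕ) : 1 ≤ T.node a k := T.one_le k _ (T.node_mem a k)

theorem lt_node (k : ℕ) : k < T.node a k := by
  have h := (T.node_strictMono a).add_le_nat k 0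
  have h0 := T.one_le_node a 0
  simp only [Nat.add_zero] at h
  omega

/-- All indices of one level precede those of the next, so two paths can only share a block at equal
levels. -/
theorem node_ne_of_node_ne {k : ℕ} (h : T.node a k ≠ T.node a' k) (k' : ℕ) :
    T.node a k ≠ T.node a' k' := by
  rcases lt_trichotomy k k' with hk | rfl | hk
  · have h1 := T.lt_of_mem k _ (T.node_mem a k) _ (T.node_mem a' (k + 1))
    have h2 := (T.node_strictMono a').monotone (Nat.succ_le_of_lt hk)
    exact (h1.trans_le h2).ne
  · exact h
  · obtain ⟨k, rfl⟩ : ∃ j, k = j + 1 := ⟨k - 1, by omega⟩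
    have h1 := T.lt_of_mem k _ (T.node_mem a' k) _ (T.node_mem a (k + 1))
    have h2 := (T.node_strictMono a').monotone (Nat.le_of_lt_succ hk)
    exact (h2.trans_lt h1).ne'

theorem node_congr {k : ℕ} (h : ∀ j < k, a j = a' j) : T.node a k = T.node a' k := by
  induction k with
  | zero => rfl
  | succ k ih => rw [node, node, ih fun j hj => h j (by omega), h k (by omega)]

variable (hlam : ∀ n, 0 < lam n)

theorem rootPos_node_succ_coord (k m : ℕ) :
    (rootPos (u₀ := u₀) hlam K X (T.node a (k + 1))).coord m =
      if m = T.node a k then X (T.node a (k + 1) - 1)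
      else (rootPos (u₀ := u₀) hlam K X (T.node a k)).coord m :=
  rootPos_coord_of_parent K X (T.one_le_node a k) (T.node_strictMono a (Nat.lt_succ_self k))
    (T.parent k _ (T.node_mem a k) _) m

/-- Going down the path only changes coordinates indexed by the successive nodes, so coordinates
below the current node are frozen. -/
theorem rootPos_node_coord_of_le {m k k' : ℕ} (hm : m < T.node a k) (hk : k ≤ k') :
    (rootPos (u₀ := u₀) hlam K X (T.node a k')).coord m =
      (rootPos (u₀ := u₀) hlam K X (T.node a k)).coord m := by
  induction k', hk using Nat.le_induction with
  | base => rfl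
  | succ k' hk ih =>
    rw [T.rootPos_node_succ_coord, if_neg, ih]
    have := (T.node_strictMono a).monotone hk
    omega

/-- The coordinates of the leaf coded by `a`. -/
def leafCoord (m : ℕ) : U := (rootPos (u₀ := u₀) hlam K X (T.node a (m + 1))).coord m

theorem leafCoord_eq {m k : ℕ} (hm : m < T.node a k) :
    T.leafCoord a hlam m = (rootPos (u₀ := u₀) hlam K X (T.node a k)).coord m := by
  have hm' : m < T.node a (m + 1) := by have := T.lt_node a (m + 1); omega
  rw [leafCoord]
  rcases le_total k (m + 1) with h | h
  · exact T.rootPos_node_coord_of_le a hlam hm h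
  · exact (T.rootPos_node_coord_of_le a hlam hm' h).symm

theorem leafCoord_node (k : ℕ) :
    T.leafCoord a hlam (T.node a k) = X (T.node a (k + 1) - 1) := by
  rw [T.leafCoord_eq a hlam (T.node_strictMono a (Nat.lt_succ_self k)),
    T.rootPos_node_succ_coord, if_pos rfl]

theorem leafCoord_of_notMem {m : ℕ} (hm : T.root ≤ m) (h : ∀ k, m ≠ T.node a k) :
    T.leafCoord a hlam m = u₀ := by
  have key : ∀ k, (rootPos (u₀ := u₀) hlam K X (T.node a k)).coord m = u₀ := by
    intro k
    induction k with
    | zero => exact rootPos_coord_of_le hlam K X _ m hm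
    | succ k ih => rw [T.rootPos_node_succ_coord, if_neg (h k), ih]
  exact key _

theorem summable_leafCoord (hb : Summable b) :
    Summable fun m => lam m * dist (T.leafCoord a hlam m) u₀ := by
  -- The finitely many coordinates below the tree root are discarded; above it only those on the
  -- path are nontrivial, and `b` dominates them.
  have key : Summable fun m => if m < T.root then 0 else lam m * dist (T.leafCoord a hlam m) u₀ := by
    refine ((T.node_strictMono a).injective.summable_iff ?_).1 ?_
    · intro m hm
      split_ifs with h
      · rfl
      · rw [T.leafCoord_of_notMem a hlam (not_lt.1 h) fun k hk => hm ⟨k, hk.symm⟩, dist_self,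
          mul_zero]
    · refine Summable.of_nonneg_of_le (fun k => ?_) (fun k => ?_) hb
      · simp only [Function.comp]
        split_ifs
        · exact le_rfl
        · exact mul_nonneg (hlam _).le dist_nonneg
      · have : ¬ T.node a k < T.root := not_lt.2 ((T.node_strictMono a).monotone (Nat.zero_le k))
        simp only [Function.comp, if_neg this, leafCoord_node]
        exact T.bounded k _ (T.node_mem a k) _
  refine (summable_congr_cofinite ?_).1 key
  refine (Set.finite_Iio T.root).subset fun m hm => ?_
  by_contra h
  exact hm (if_neg h)

/-- The leaf coded by `a`. -/
def leaf (hb : Summable b) : Ambient u₀ lam hlam :=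
  ⟨T.leafCoord a hlam, T.summable_leafCoord a hlam hb⟩

variable (hb : Summable b)

/-- The root of the `k`-th block on the path is the leaf truncated at coordinate `node a k`, so the
distance is the tail of a convergent series. -/
theorem dist_rootPos_leaf (k : ℕ) :
    dist (rootPos hlam K X (T.node a k)) (T.leaf a hlam hb) =
      ∑' m, lam (m + T.node a k) * dist (T.leafCoord a hlam (m + T.node a k)) u₀ := by
  rw [Ambient.dist_eq, ← (Ambient.summable_dist _ _).sum_add_tsum_nat_add (T.node a k),
    Finset.sum_eq_zero, zero_add]
  · refine tsum_congr fun m => ?_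
    rw [rootPos_coord_of_le hlam K X _ _ (Nat.le_add_left _ _), dist_comm]
    rfl
  · intro m hm
    rw [← T.leafCoord_eq a hlam (Finset.mem_range.1 hm)]
    simp [leaf]

theorem tendsto_rootPos_leaf :
    Tendsto (fun k => rootPos hlam K X (T.node a k)) atTop (𝓝 (T.leaf a hlam hb)) := by
  rw [tendsto_iff_dist_tendsto_zero]
  simp only [T.dist_rootPos_leaf a hlam hb]
  exact (tendsto_sum_nat_add fun m => lam m * dist (T.leafCoord a hlam m) u₀).comp
    (T.node_strictMono a).tendsto_atTop

/-- The leaf is a limit of roots of blocks, and infinitely many of its coordinates are at distance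
at least `c` from `u₀`, which no point of the skeleton allows. -/
theorem leaf_mem_leaves [MeasurableSpace U] [BorelSpace U] (B : ℕ → Block U u₀) (hc : 0 < c) :
    T.leaf a hlam hb ∈ leaves hlam B K X := by
  refine ⟨mem_closure_of_tendsto (T.tendsto_rootPos_leaf a hlam hb)
    (Eventually.of_forall fun k => rootPos_mem_skeleton B K X (T.one_le_node a k)), fun h => ?_⟩
  obtain ⟨n, hn⟩ := coord_eq_of_mem_skeleton h
  have h1 : T.leafCoord a hlam (T.node a n) = u₀ := hn _ (T.lt_node a n)
  rw [T.leafCoord_node] at h1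
  have h2 := T.far n _ (T.node_mem a n) (a n)
  rw [show T.child n (T.node a n) (a n) = T.node a (n + 1) from rfl, h1, dist_self] at h2
  exact hc.not_ge h2

/-- Look at the coordinate `node a k`: the first leaf goes through this block to a grafting point
far from its root, the second never enters it. -/
theorem le_dist_leaf {k : ℕ} (hc : 0 < c) (h : T.node a k ≠ T.node a' k) :
    c * l k ≤ dist (T.leaf a hlam hb) (T.leaf a' hlam hb) := by
  refine le_trans ?_ (Ambient.mul_dist_coord_le _ _ (T.node a k))
  have h1 : (T.leaf a hlam hb).coord (T.node a k) = X (T.node a (k + 1) - 1) :=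
    T.leafCoord_node a hlam k
  have h2 : (T.leaf a' hlam hb).coord (T.node a k) = u₀ :=
    T.leafCoord_of_notMem a' hlam ((T.node_strictMono a).monotone (Nat.zero_le k))
      (T.node_ne_of_node_ne a a' h)
  rw [h1, h2, mul_comm c]
  have h3 := T.far k _ (T.node_mem a k) (a k)
  have h4 := T.le_lam k _ (T.node_mem a k)
  exact mul_le_mul h4 h3 hc.le (hlam _).le

theorem eq_of_dist_leaf_lt {k : ℕ} (hc : 0 < c) (hl : Antitone l)
    (h : dist (T.leaf a hlam hb) (T.leaf a' hlam hb) < c * l k) : ∀ j < k, a j = a' j := by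
  intro j
  induction j using Nat.strong_induction_on with
  | _ j ih =>
    intro hj
    by_contra hne
    have h1 : T.node a j = T.node a' j := T.node_congr a a' fun i hi => ih i hi (hi.trans hj)
    have h2 : T.node a (j + 1) ≠ T.node a' (j + 1) := by
      rw [node, node, ← h1]
      exact fun h3 => hne (T.injective j _ (T.node_mem a j) h3)
    have h3 := T.le_dist_leaf a a' hlam hb hc h2
    have h4 : c * l k ≤ c * l (j + 1) := mul_le_mul_of_nonneg_left (hl hj) hc.le
    linarith

theorem measurable_node (k : ℕ) : Measurable fun a => T.node a k := by
  induction k with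
  | zero => exact measurable_const
  | succ k ih =>
    have h : Measurable fun p : ℕ × Fin (T.size k) => T.child k p.1 p.2 := measurable_of_countable _
    exact h.comp (ih.prodMk (measurable_pi_apply k))

/-- The leaf is a pointwise limit of maps that factor through the index `node a k`, which takes
values in a countable set. -/
theorem measurable_leaf [MeasurableSpace (Ambient u₀ lam hlam)] [BorelSpace (Ambient u₀ lam hlam)] :
    Measurable fun a => T.leaf a hlam hb := by
  refine measurable_of_tendsto_metrizable (fun k => ?_)
    (tendsto_pi_nhds.2 fun a => T.tendsto_rootPos_leaf a hlam hb)
  exact (measurable_of_countable (rootPos hlam K X)).comp (T.measurable_node k)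

/-- The law of a uniformly chosen path. -/
noncomputable def pathMeasure : Measure ((k : ℕ) → Fin (T.size k)) :=
  Measure.infinitePi fun k =>
    haveI : Nonempty (Fin (T.size k)) := ⟨⟨0, T.size_pos k⟩⟩
    uniformOn Set.univ

instance : IsProbabilityMeasure T.pathMeasure := by
  have (k : ℕ) : Nonempty (Fin (T.size k)) := ⟨⟨0, T.size_pos k⟩⟩
  unfold pathMeasure
  infer_instance

theorem pathMeasure_cylinder_le (k : ℕ) (J : Finset (Fin (T.size k))) :
    T.pathMeasure {a' | (∀ j < k, a j = a' j) ∧ a' k ∈ J} ≤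
      ENNReal.ofReal (J.card / ∏ j ∈ Finset.range (k + 1), (T.size j : ℝ)) := by
  classical
  have (k : ℕ) : Nonempty (Fin (T.size k)) := ⟨⟨0, T.size_pos k⟩⟩
  -- A box with sides `{a j}` for `j < k` and `J` at `j = k`; the transport only serves to type `J`
  -- in the dependent product.
  let t : (j : ℕ) → Set (Fin (T.size j)) := fun j =>
    if j < k then {a j} else {x | ∀ h : j = k, h ▸ x ∈ J}
  have ht : {a' : (j : ℕ) → Fin (T.size j) | (∀ j < k, a j = a' j) ∧ a' k ∈ J} ⊆
      Set.pi (Finset.range (k + 1) : Finset ℕ) t := by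
    rintro a' ⟨h1, h2⟩ j hj
    simp only [t]
    split_ifs with h
    · exact (h1 j h).symm
    · rintro rfl
      exact h2
  refine (measure_mono ht).trans ?_
  unfold pathMeasure
  rw [Measure.infinitePi_pi _ fun j _ => MeasurableSet.of_discrete, Finset.prod_range_succ]
  have h1 : ∀ j ∈ Finset.range k,
      uniformOn (Set.univ : Set (Fin (T.size j))) (t j) = (T.size j : ℝ≥0∞)⁻¹ := by
    intro j hj
    have : t j = {a j} := if_pos (Finset.mem_range.1 hj)
    rw [this, uniformOn_univ, Measure.count_singleton, Fintype.card_fin, one_div]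
  have h2 : uniformOn (Set.univ : Set (Fin (T.size k))) (t k) =
      (J.card : ℝ≥0∞) / (T.size k : ℝ≥0∞) := by
    have : t k = (J : Set (Fin (T.size k))) := by
      ext x
      simp [t]
    rw [this, uniformOn_univ, Measure.count_apply_finset, Fintype.card_fin]
  rw [Finset.prod_congr rfl h1, h2, Finset.prod_range_succ]
  have hpos : ∀ j, (0 : ℝ) < T.size j := fun j => Nat.cast_pos.2 (T.size_pos j)
  have h3 : ∏ j ∈ Finset.range k, (T.size j : ℝ≥0∞)⁻¹ =
      ENNReal.ofReal (∏ j ∈ Finset.range k, (T.size j : ℝ)⁻¹) := by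
    rw [ENNReal.ofReal_prod_of_nonneg fun j _ => (inv_pos.2 (hpos j)).le]
    refine Finset.prod_congr rfl fun j _ => ?_
    rw [ENNReal.ofReal_inv_of_pos (hpos j), ENNReal.ofReal_natCast]
  have h4 : (J.card : ℝ≥0∞) / (T.size k : ℝ≥0∞) = ENNReal.ofReal (J.card / T.size k) := by
    rw [ENNReal.ofReal_div_of_pos (hpos k), ENNReal.ofReal_natCast, ENNReal.ofReal_natCast]
  rw [h3, h4, ← ENNReal.ofReal_mul (Finset.prod_nonneg fun j _ => (inv_pos.2 (hpos j)).le)]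
  refine ENNReal.ofReal_le_ofReal (le_of_eq ?_)
  rw [Finset.prod_inv_distrib, div_eq_mul_inv, div_eq_mul_inv, mul_inv]
  ring

/-- Choose `k` with `c * l (k + 1) ≤ r < c * l k`. Leaves this close agree on the first `k` choices,
hence share the block of level `k`, and their next grafting points are within `r / l k`; so few
cylinders of depth `k + 1` are met. -/
theorem pathMeasure_leaf_preimage_le {C σ r : ℝ} (hc : 0 < c) (hl : Antitone l)
    (hlpos : ∀ k, 0 < l k) (hl0 : Tendsto l atTop (𝓝 0))
    (hcnt : ∀ k, ∀ r : ℝ, c * l (k + 1) ≤ r → r < c * l k →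
      cnt k (r / l k) ≤ C * r ^ σ * ∏ j ∈ Finset.range (k + 1), (T.size j : ℝ))
    (hr0 : 0 < r) (hr : r < c * l 0) {S : Set (Ambient u₀ lam hlam)}
    (hS : ∀ x ∈ S, ∀ y ∈ S, dist x y ≤ r) :
    T.pathMeasure ((fun a => T.leaf a hlam hb) ⁻¹' S) ≤ ENNReal.ofReal (C * r ^ σ) := by
  classical
  obtain ⟨k, hk1, hk2⟩ : ∃ k, c * l (k + 1) ≤ r ∧ r < c * l k := by
    have h0 : Tendsto (fun k => c * l k) atTop (𝓝 0) := by simpa using hl0.const_mul c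
    have hex : ∃ k, c * l k ≤ r :=
      ((h0.eventually (eventually_lt_nhds hr0)).exists).imp fun k hk => hk.le
    have h1 : Nat.find hex ≠ 0 := fun h => by
      have := Nat.find_spec hex
      rw [h] at this
      linarith
    refine ⟨Nat.find hex - 1, ?_, ?_⟩
    · rw [Nat.sub_add_cancel (Nat.pos_of_ne_zero h1)]
      exact Nat.find_spec hex
    · exact not_le.1 (Nat.find_min hex (by omega))
  rcases ((fun a => T.leaf a hlam hb) ⁻¹' S).eq_empty_or_nonempty with h | ⟨a, ha⟩
  · rw [h, measure_empty]
    exact zero_le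
  set J : Finset (Fin (T.size k)) := Finset.univ.filter fun t =>
    dist (X (T.child k (T.node a k) t - 1)) (X (T.node a (k + 1) - 1)) ≤ r / l k with hJ
  have hsub : (fun a => T.leaf a hlam hb) ⁻¹' S ⊆ {a' | (∀ j < k, a j = a' j) ∧ a' k ∈ J} := by
    intro a' ha'
    have hd := hS _ ha' _ ha
    have hpre : ∀ j < k, a j = a' j := T.eq_of_dist_leaf_lt a a' hlam hb hc hl (by
      rw [dist_comm]; exact hd.trans_lt hk2)
    refine ⟨hpre, ?_⟩
    have hnode := T.node_congr a a' hpre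
    have h1 := (Ambient.mul_dist_coord_le _ _ (T.node a k)).trans hd
    have h2 : (T.leaf a hlam hb).coord (T.node a k) = X (T.node a (k + 1) - 1) :=
      T.leafCoord_node a hlam k
    have h3 : (T.leaf a' hlam hb).coord (T.node a k) = X (T.node a' (k + 1) - 1) := by
      rw [hnode]
      exact T.leafCoord_node a' hlam k
    rw [h2, h3] at h1
    simp only [hJ, Finset.mem_filter, Finset.mem_univ, true_and]
    rw [show T.child k (T.node a k) (a' k) = T.node a' (k + 1) by rw [hnode]; rfl,
      le_div_iff₀ (hlpos k), mul_comm]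
    exact (mul_le_mul_of_nonneg_right (T.le_lam k _ (T.node_mem a k)) dist_nonneg).trans h1
  refine ((measure_mono hsub).trans (T.pathMeasure_cylinder_le a k J)).trans ?_
  refine ENNReal.ofReal_le_ofReal ?_
  rw [div_le_iff₀ (Finset.prod_pos fun j _ => Nat.cast_pos.2 (T.size_pos j))]
  exact (T.spread k _ (T.node_mem a k) _ _).trans (hcnt k r hk1 hk2)

/-- Mass distribution principle on a tree of blocks. -/
theorem ofReal_le_dimH_leaves [MeasurableSpace U] [BorelSpace U] (B : ℕ → Block U u₀)
    (hb : Summable b) {C σ : ℝ} (hσ : 0 < σ) (hC : 0 < C) (hc : 0 < c) (hl : Antitone l)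
    (hlpos : ∀ k, 0 < l k) (hl0 : Tendsto l atTop (𝓝 0))
    (hcnt : ∀ k, ∀ r : ℝ, c * l (k + 1) ≤ r → r < c * l k →
      cnt k (r / l k) ≤ C * r ^ σ * ∏ j ∈ Finset.range (k + 1), (T.size j : ℝ)) :
    ENNReal.ofReal σ ≤ dimH (leaves hlam B K X) := by
  let _ : MeasurableSpace (Ambient u₀ lam hlam) := borel _
  have : BorelSpace (Ambient u₀ lam hlam) := ⟨rfl⟩
  set f := fun a => T.leaf a hlam hb with hf
  have hfm : Measurable f := T.measurable_leaf hlam hb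
  set μ : Measure (Ambient u₀ lam hlam) := (ENNReal.ofReal C)⁻¹ • T.pathMeasure.map f with hμ
  have hC0 : ENNReal.ofReal C ≠ 0 := by simpa using hC
  have hCt : ENNReal.ofReal C ≠ ∞ := ENNReal.ofReal_ne_top
  have hr1 : 0 < c * l 0 / 2 := by have := mul_pos hc (hlpos 0); linarith
  have hle : μ ≤ μH[σ] := by
    refine Measure.le_hausdorffMeasure σ μ (ENNReal.ofReal (c * l 0 / 2)) (by simpa using hr1) ?_
    intro S hS
    -- Passing to the closure keeps the diameter and makes the set measurable, as needed to evaluate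
    -- the image measure.
    rw [← Metric.ediam_closure] at hS ⊢
    refine (measure_mono (subset_closure (s := S))).trans ?_
    have hSt : Metric.ediam (closure S) ≠ ∞ := ne_top_of_le_ne_top ENNReal.ofReal_ne_top hS
    have key : ∀ r : ℝ, 0 < r → r < c * l 0 → Metric.ediam (closure S) ≤ ENNReal.ofReal r →
        μ (closure S) ≤ ENNReal.ofReal r ^ σ := by
      intro r hr hr' hd
      have h1 := T.pathMeasure_leaf_preimage_le hlam hb hc hl hlpos hl0 hcnt hr hr'
        (S := closure S) fun x hx y hy => by
          have := (Metric.edist_le_ediam_of_mem hx hy).trans hd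
          rwa [edist_dist, ENNReal.ofReal_le_ofReal_iff hr.le] at this
      rw [hμ, Measure.smul_apply, Measure.map_apply hfm isClosed_closure.measurableSet,
        smul_eq_mul]
      refine (mul_le_mul_right h1 _).trans ?_
      rw [ENNReal.ofReal_mul hC.le, ← mul_assoc, ENNReal.inv_mul_cancel hC0 hCt, one_mul,
        ENNReal.ofReal_rpow_of_pos hr]
    -- A set of zero diameter is handled by letting `r` decrease to `0`, the estimate being
    -- available for `r > 0` only.
    rcases eq_or_ne (Metric.ediam (closure S)) 0 with h0 | h0
    · rw [h0, ENNReal.zero_rpow_of_pos hσ]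
      have hlim : Tendsto (fun r : ℝ => ENNReal.ofReal r ^ σ) (𝓝[>] 0) (𝓝 0) := by
        have : Tendsto (fun r : ℝ => ENNReal.ofReal r ^ σ) (𝓝 0) (𝓝 (ENNReal.ofReal 0 ^ σ)) :=
          (ENNReal.continuous_rpow_const.comp ENNReal.continuous_ofReal).tendsto 0
        rw [ENNReal.ofReal_zero, ENNReal.zero_rpow_of_pos hσ] at this
        exact this.mono_left nhdsWithin_le_nhds
      refine ge_of_tendsto hlim ?_
      filter_upwards [Ioo_mem_nhdsGT (show (0 : ℝ) < c * l 0 by linarith)] with r hr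
      exact key r hr.1 hr.2 (by rw [h0]; exact zero_le)
    · have h1 := key (Metric.ediam (closure S)).toReal (ENNReal.toReal_pos h0 hSt)
        (lt_of_le_of_lt (ENNReal.toReal_le_of_le_ofReal hr1.le hS) (by linarith))
        (ENNReal.ofReal_toReal hSt).ge
      rwa [ENNReal.ofReal_toReal hSt] at h1
  have hne : μH[σ] (leaves hlam B K X) ≠ 0 := by
    intro h0
    have h1 : μ (leaves hlam B K X) = 0 := le_antisymm ((hle _).trans h0.le) zero_le
    rw [hμ, Measure.smul_apply, smul_eq_mul, mul_eq_zero] at h1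
    have h2 := h1.resolve_left (ENNReal.inv_ne_zero.2 hCt)
    have h3 := Measure.le_map_apply hfm.aemeasurable (μ := T.pathMeasure) (leaves hlam B K X)
    have h4 : f ⁻¹' leaves hlam B K X = Set.univ :=
      Set.eq_univ_of_forall fun a => T.leaf_mem_leaves a hlam hb B hc
    rw [h2, h4, measure_univ] at h3
    simp at h3
  have h5 : μH[((⟨σ, hσ.le⟩ : NNReal) : ℝ)] (leaves hlam B K X) ≠ 0 := hne
  have h6 := le_dimH_of_hausdorffMeasure_ne_zero h5
  rwa [ENNReal.ofReal, Real.toNNReal_of_nonneg hσ.le]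

end BlockTree

end Tree

/-! ### Measurability of the mass of a block -/

section BlockMeasure

variable {U : Type*} [MetricSpace U] [MeasurableSpace U] {u₀ : U}

instance (b : Block U u₀) : IsProbabilityMeasure b.meas := b.1.2.2

theorem Block.meas_inter_carrier (b : Block U u₀) (A : Set U) :
    b.meas (A ∩ b.carrier) = b.meas A := by
  have h : b.meas b.carrierᶜ = 0 := b.2.2
  exact measure_inter_conull h

variable [BorelSpace U]

/-- This is the portmanteau inequality for open sets; since open sets form a generating π-system, it
makes the mass of every Borel set measurable in the block. -/
theorem Block.lowerSemicontinuous_meas {G : Set U} (hG : IsOpen G) :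
    LowerSemicontinuous fun b : Block U u₀ => b.meas G := by
  intro b y hy
  have hc : Continuous fun b : Block U u₀ => b.1.2 := continuous_snd.comp continuous_subtype_val
  exact eventually_lt_of_lt_liminf (hy.trans_le
    (ProbabilityMeasure.le_liminf_measure_open_of_tendsto (hc.tendsto b) hG))

theorem Block.measurable_meas : Measurable fun b : Block U u₀ => b.meas := by
  refine Measurable.measure_of_isPiSystem_of_isProbabilityMeasure
    (S := {G : Set U | IsOpen G}) (BorelSpace.measurable_eq) isPiSystem_isOpen ?_
  intro G hG
  exact (Block.lowerSemicontinuous_meas hG).measurable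

theorem Block.measurable_meas_apply {Y : Set U} (hY : MeasurableSet Y) :
    Measurable fun b : Block U u₀ => b.meas Y :=
  (Measure.measurable_coe hY).comp Block.measurable_meas

end BlockMeasure

/-! ### Cells -/

section Cells

variable {U : Type*} [MetricSpace U]

/-- The points at distance between `1 / (t + 1)` and `t + 1` from `u₀`. -/
def annulus (u₀ : U) (t : ℕ) : Set U :=
  {x | 1 / ((t : ℝ) + 1) ≤ dist x u₀ ∧ dist x u₀ ≤ (t : ℝ) + 1}

theorem annulus_mono (u₀ : U) : Monotone (annulus u₀) := by
  intro s t hst x hx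
  have h : (s : ℝ) ≤ t := Nat.cast_le.2 hst
  have hs : (0 : ℝ) ≤ s := Nat.cast_nonneg s
  refine ⟨le_trans ?_ hx.1, hx.2.trans (by linarith)⟩
  exact one_div_le_one_div_of_le (by linarith) (by linarith)

theorem exists_mem_annulus {u₀ x : U} (hx : x ≠ u₀) : ∃ t, x ∈ annulus u₀ t := by
  obtain ⟨s, hs⟩ := exists_nat_one_div_lt (dist_pos.2 hx)
  obtain ⟨t, ht⟩ := exists_nat_ge (dist x u₀)
  have h1 : (s : ℝ) ≤ (max s t : ℕ) := Nat.cast_le.2 (le_max_left s t)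
  have h2 : (t : ℝ) ≤ (max s t : ℕ) := Nat.cast_le.2 (le_max_right s t)
  have h3 : (0 : ℝ) ≤ s := Nat.cast_nonneg s
  exact ⟨max s t, (one_div_le_one_div_of_le (by linarith) (by linarith)).trans hs.le,
    by linarith⟩

theorem isClosed_annulus (u₀ : U) (t : ℕ) : IsClosed (annulus u₀ t) := by
  have hc : Continuous fun x : U => dist x u₀ := continuous_id.dist continuous_const
  exact (isClosed_le continuous_const hc).inter (isClosed_le hc continuous_const)

/-- The annuli increase to the complement of `u₀`, so one of them is charged; enlarging `t` then
also brings the threshold `1 / (t + 1)` below its mass. -/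
theorem exists_le_measure_annulus [MeasurableSpace U] {u₀ : U} (μ : Measure U)
    (h : μ {u₀}ᶜ ≠ 0) : ∃ t : ℕ, ∀ t' : ℕ, t ≤ t' →
      ENNReal.ofReal (1 / ((t' : ℝ) + 1)) ≤ μ (annulus u₀ t') := by
  have h1 : ∃ t, μ (annulus u₀ t) ≠ 0 := by
    by_contra! h0
    refine h (measure_mono_null (fun x hx => ?_) (measure_iUnion_null h0))
    exact Set.mem_iUnion.2 (exists_mem_annulus hx)
  obtain ⟨t, ht⟩ := h1
  have hlim : Tendsto (fun n : ℕ => ENNReal.ofReal (1 / ((n : ℝ) + 1))) atTop (𝓝 0) := by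
    simpa using ENNReal.tendsto_ofReal tendsto_one_div_add_atTop_nhds_zero_nat
  obtain ⟨s, hs⟩ := eventually_atTop.1
    (hlim.eventually (eventually_lt_nhds (pos_iff_ne_zero.2 ht)))
  refine ⟨max s t, fun t' ht' => ?_⟩
  exact (hs t' ((le_max_left s t).trans ht')).le.trans
    (measure_mono (annulus_mono u₀ ((le_max_right s t).trans ht')))

/-- Greedy choice: as long as the balls around the chosen points have total mass less than that of
`A`, some point of `A` lies outside all of them. -/
theorem exists_separated_of_lt_measure [MeasurableSpace U] (μ : Measure U) (A : Set U) (ρ : ℝ)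
    (v : ℝ≥0∞) (hv : ∀ x ∈ A, μ (Metric.ball x ρ) ≤ v) (n : ℕ) (hn : n * v < μ A) :
    ∃ x : Fin n → U, (∀ i, x i ∈ A) ∧ Pairwise fun i j => ρ ≤ dist (x i) (x j) := by
  induction n with
  | zero => exact ⟨Fin.elim0, fun i => i.elim0, fun i => i.elim0⟩
  | succ n ih =>
    have hn' : (n : ℝ≥0∞) * v < μ A := lt_of_le_of_lt (by gcongr; exact n.le_succ) hn
    obtain ⟨x, hxA, hx⟩ := ih hn'
    have h1 : μ (⋃ i, Metric.ball (x i) ρ) < μ A := by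
      refine lt_of_le_of_lt ((measure_iUnion_fintype_le _ _).trans ?_) hn'
      refine (Finset.sum_le_sum fun i _ => hv _ (hxA i)).trans ?_
      simp
    obtain ⟨y, hyA, hy⟩ : ∃ y ∈ A, y ∉ ⋃ i, Metric.ball (x i) ρ := by
      by_contra! h
      exact h1.not_ge (measure_mono h)
    simp only [Set.mem_iUnion, Metric.mem_ball, not_exists, not_lt] at hy
    refine ⟨Fin.snoc x y, fun i => ?_, fun i j hij => ?_⟩
    · refine Fin.lastCases ?_ (fun i => ?_) i
      · simpa using hyA
      · simpa using hxA i
    · induction i using Fin.lastCases with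
      | last =>
        induction j using Fin.lastCases with
        | last => exact absurd rfl hij
        | cast j => simpa using hy j
      | cast i =>
        induction j using Fin.lastCases with
        | last => simpa [dist_comm] using hy i
        | cast j => simpa using hx (fun h => hij (congrArg Fin.castSucc h))

/-- A finite family of disjoint Borel cells away from `u₀`, such that a closed ball of radius `ρ`
meets at most `max 1 (C * R ^ (-D₂) * ρ ^ D₁)` of them. -/
structure IsCellFamily [MeasurableSpace U] (u₀ : U) (c M C D₁ D₂ R : ℝ) {m : ℕ}
    (S : Fin m → Set U) : Prop where
  measurableSet : ∀ j, MeasurableSet (S j)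
  far : ∀ j, ∀ x ∈ S j, c ≤ dist x u₀
  bounded : ∀ j, ∀ x ∈ S j, dist x u₀ ≤ M
  disjoint : Pairwise fun i j => Disjoint (S i) (S j)
  spread : ∀ (z : U) (ρ : ℝ) (J : Finset (Fin m)),
    (∀ j ∈ J, ∃ x ∈ S j, dist x z ≤ ρ) → (J.card : ℝ) ≤ max 1 (C * R ^ (-D₂) * ρ ^ D₁)

/-- Balls around points close to a well separated family of points form a cell family, when the
masses of balls are controlled by powers of their radii. -/
theorem isCellFamily_ball [MeasurableSpace U] [BorelSpace U] {u₀ : U} (μ : Measure U)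
    [IsProbabilityMeasure μ] {d ε η M R : ℝ} (hε : 0 < ε) (hεd : ε < d) (hη : 0 < η) (hη1 : η ≤ 1)
    (hR : 0 < R) (hRη : 7 * R < η) {A : Set U}
    (hA : ∀ x ∈ A, ∀ r ∈ Set.Ioo 0 η, r ^ (d + ε / 2) ≤ μ.real (Metric.ball x r) ∧
      μ.real (Metric.ball x r) ≤ r ^ (d - ε / 2))
    (hfar : ∀ x ∈ A, η ≤ dist x u₀) (hbd : ∀ x ∈ A, dist x u₀ ≤ M)
    {m : ℕ} (hm : (m : ℝ) ≤ R ^ (-(d - ε))) {x y : Fin m → U} (hxA : ∀ i, x i ∈ A)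
    (hx : Pairwise fun i j => 8 * R ≤ dist (x i) (x j)) (hxy : ∀ i, dist (x i) (y i) < R / 2) :
    IsCellFamily u₀ (η / 2) (M + 1) ((7 / η) ^ d) (d - ε) (d + ε) R
      fun i => Metric.ball (y i) R where
  measurableSet j := Metric.isOpen_ball.measurableSet
  far j z hz := by
    have h1 := hfar _ (hxA j)
    have h2 := hxy j
    have h3 := Metric.mem_ball.1 hz
    have h4 := dist_triangle4 (x j) (y j) z u₀
    rw [dist_comm z] at h3
    linarith
  bounded j z hz := by
    have h1 := hbd _ (hxA j)
    have h2 := hxy j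
    have h3 := Metric.mem_ball.1 hz
    have h4 := dist_triangle4 z (y j) (x j) u₀
    rw [dist_comm (x j)] at h2
    linarith
  disjoint i j hij := by
    refine Metric.ball_disjoint_ball ?_
    have h1 := hx hij
    have h2 := hxy i
    have h3 := hxy j
    have h4 := dist_triangle4 (x i) (y i) (y j) (x j)
    rw [dist_comm (x j)] at h3
    linarith
  spread z ρ J hJ := by
    have hd : 0 < d := hε.trans hεd
    have hR1 : R ≤ 1 := by linarith
    have hJd : ∀ i ∈ J, ∀ j ∈ J, dist (x i) (x j) < 3 * R + 2 * ρ := by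
      intro i hi j hj
      obtain ⟨a, ha, haz⟩ := hJ i hi
      obtain ⟨b, hb, hbz⟩ := hJ j hj
      have h2 := hxy i
      have h3 := hxy j
      have h4 := dist_triangle4 (x i) (y i) a z
      have h5 := dist_triangle4 (x j) (y j) b z
      have h6 := dist_triangle_right (x i) (x j) z
      have ha' := Metric.mem_ball.1 ha
      have hb' := Metric.mem_ball.1 hb
      rw [dist_comm] at ha' hb'
      linarith
    -- For `ρ < R` two centres would be closer than `5 * R`, against the separation `8 * R`.
    rcases lt_or_ge ρ R with hρ | hρ
    · refine le_max_of_le_left ?_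
      have : J.card ≤ 1 := by
        refine Finset.card_le_one.2 fun i hi j hj => ?_
        by_contra hij
        have h1 := hJd i hi j hj
        have h2 := hx hij
        linarith
      exact_mod_cast this
    refine le_max_of_le_right ?_
    have hρ0 : 0 < ρ := hR.trans_le hρ
    have hRpow : R ^ (-(d + ε / 2)) ≤ R ^ (-(d + ε)) :=
      Real.rpow_le_rpow_of_exponent_ge hR hR1 (by linarith)
    have h7 : 1 ≤ 7 / η := by rw [le_div_iff₀ hη]; linarith
    -- For small `ρ`, compare volumes: the disjoint balls of radius `R` around the selected centres
    -- fit in one ball of radius `7 * ρ`. For large `ρ`, the total number of cells is already a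
    -- sufficient bound.
    rcases lt_or_ge (7 * ρ) η with hρη | hρη
    · rcases J.eq_empty_or_nonempty with rfl | ⟨i₀, hi₀⟩
      · simp only [Finset.card_empty, Nat.cast_zero]
        positivity
      have h1 : (J.card : ℝ) * R ^ (d + ε / 2) ≤ μ.real (⋃ i ∈ J, Metric.ball (x i) R) := by
        rw [measureReal_biUnion_finset]
        · rw [← nsmul_eq_mul]
          exact Finset.card_nsmul_le_sum _ _ _ fun i _ => (hA _ (hxA i) R ⟨hR, by linarith⟩).1
        · intro i _ j _ hij
          exact Metric.ball_disjoint_ball (by have := hx hij; linarith)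
        · exact fun i _ => Metric.isOpen_ball.measurableSet
      have h2 : μ.real (⋃ i ∈ J, Metric.ball (x i) R) ≤ (7 * ρ) ^ (d - ε / 2) := by
        refine le_trans ?_ (hA _ (hxA i₀) (7 * ρ) ⟨by linarith, hρη⟩).2
        refine measureReal_mono (Set.iUnion₂_subset fun i hi => ?_)
        refine Metric.ball_subset_ball' ?_
        have := hJd i hi i₀ hi₀
        linarith
      have h3 : (7 * ρ) ^ (d - ε / 2) ≤ (7 / η) ^ d * ρ ^ (d - ε) := by
        rw [Real.mul_rpow (by norm_num) hρ0.le]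
        refine mul_le_mul ?_ ?_ (Real.rpow_nonneg hρ0.le _) (by positivity)
        · refine (Real.rpow_le_rpow (by norm_num) ?_ (by linarith)).trans
            (Real.rpow_le_rpow_of_exponent_le h7 (by linarith))
          rw [le_div_iff₀ hη]
          linarith
        · exact Real.rpow_le_rpow_of_exponent_ge hρ0 (by linarith) (by linarith)
      have h4 : (J.card : ℝ) ≤ (7 / η) ^ d * ρ ^ (d - ε) * R ^ (-(d + ε / 2)) := by
        rw [Real.rpow_neg hR.le, ← div_eq_mul_inv, le_div_iff₀ (Real.rpow_pos_of_pos hR _)]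
        exact (h1.trans h2).trans h3
      refine h4.trans ?_
      calc (7 / η) ^ d * ρ ^ (d - ε) * R ^ (-(d + ε / 2))
          ≤ (7 / η) ^ d * ρ ^ (d - ε) * R ^ (-(d + ε)) := by gcongr
        _ = (7 / η) ^ d * R ^ (-(d + ε)) * ρ ^ (d - ε) := by ring
    · have h1 : (J.card : ℝ) ≤ R ^ (-(d + ε)) := by
        have : J.card ≤ m := (Finset.card_le_univ J).trans_eq (Fintype.card_fin m)
        refine ((Nat.cast_le.2 this).trans hm).trans ?_
        exact Real.rpow_le_rpow_of_exponent_ge hR hR1 (by linarith)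
      have h2 : 1 ≤ (7 / η) ^ d * ρ ^ (d - ε) := by
        have h3 : (7 / η) ^ (d - ε) ≤ (7 / η) ^ d :=
          Real.rpow_le_rpow_of_exponent_le h7 (by linarith)
        have h4 : 1 ≤ (7 / η) ^ (d - ε) * ρ ^ (d - ε) := by
          rw [← Real.mul_rpow (by positivity) hρ0.le]
          refine Real.one_le_rpow ?_ (by linarith)
          rw [div_mul_eq_mul_div, le_div_iff₀ hη]
          linarith
        exact h4.trans (mul_le_mul_of_nonneg_right h3 (Real.rpow_nonneg hρ0.le _))
      calc (J.card : ℝ) ≤ R ^ (-(d + ε)) * 1 := by rwa [mul_one]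
        _ ≤ R ^ (-(d + ε)) * ((7 / η) ^ d * ρ ^ (d - ε)) := by gcongr
        _ = (7 / η) ^ d * R ^ (-(d + ε)) * ρ ^ (d - ε) := by ring

end Cells

/-! ### Cell families charged by the block with positive probability -/

section ExistsCells

theorem exists_countable_seq {U α : Type*} {m : ℕ} {𝒮 : Set (Fin m → Set U)} (h𝒮 : 𝒮.Countable)
    [MeasurableSpace α] {μ : Measure α} {E : (Fin m → Set U) → Set α} {q : ℝ≥0∞} (hq : 0 < q)
    (h : q ≤ μ (⋃ S ∈ 𝒮, E S)) :
    ∃ S : ℕ → Fin m → Set U, (∀ t, S t ∈ 𝒮) ∧ q ≤ μ (⋃ t, E (S t)) := by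
  have hne : 𝒮.Nonempty := by
    by_contra h0
    rw [Set.not_nonempty_iff_eq_empty.1 h0] at h
    simp only [Set.mem_empty_iff_false, Set.iUnion_of_empty, Set.iUnion_empty, measure_empty] at h
    exact hq.not_ge h
  obtain ⟨S, rfl⟩ := h𝒮.exists_eq_range hne
  exact ⟨S, fun t => Set.mem_range_self t, by rwa [Set.biUnion_range] at h⟩

variable {U : Type*} [MetricSpace U] [MeasurableSpace U] [BorelSpace U] {u₀ : U}

/-- One fixed annulus serves as the only cell: a nontrivial finite block charges it for some `t`, so
for some `t` its mass is bounded below with positive probability. The value of `R₀` makes `R ^ ε`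
smaller than that mass. -/
theorem HypH.exists_cells_of_eq_zero {τ : Measure (Block U u₀)} (hτ : HypH 0 τ)
    [IsProbabilityMeasure τ] {ε : ℝ} (hε : 0 < ε) :
    ∃ p c M C R₀ : ℝ, 0 < p ∧ 0 < c ∧ 0 < M ∧ 0 < C ∧ 0 < R₀ ∧ ∀ R ∈ Set.Ioo 0 R₀,
      ∃ S : ℕ → Fin ⌊R ^ (-(0 : ℝ))⌋₊ → Set U,
        (∀ t, IsCellFamily u₀ c M C 0 (0 + ε) R (S t)) ∧
        ENNReal.ofReal p ≤
          τ (⋃ t, {b | ∀ j, ENNReal.ofReal (R ^ (0 + ε)) ≤ b.meas (S t j)}) := by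
  obtain ⟨h1, h2⟩ := hτ.finite_of_eq_zero rfl
  set E : ℕ → Set (Block U u₀) := fun t =>
    {b | ENNReal.ofReal (1 / ((t : ℝ) + 1)) ≤ b.meas (annulus u₀ t)} with hE
  obtain ⟨t, ht⟩ : ∃ t, τ (E t) ≠ 0 := by
    by_contra! h0
    refine h2 ?_
    filter_upwards [h1, measure_eq_zero_iff_ae_notMem.1 (measure_iUnion_null h0)] with b hb hbE
    by_contra hne
    obtain ⟨x, hx, hxu⟩ : ∃ x ∈ b.carrier, x ≠ u₀ := by
      by_contra! h
      exact hne (Set.Subset.antisymm h (Set.singleton_subset_iff.2 b.2.1))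
    obtain ⟨t, ht⟩ := exists_le_measure_annulus b.meas (u₀ := u₀)
      ((hb.2 x hx).trans_le (measure_mono (Set.singleton_subset_iff.2 hxu))).ne'
    exact hbE (Set.mem_iUnion.2 ⟨t, ht t le_rfl⟩)
  have hη : (0 : ℝ) < 1 / ((t : ℝ) + 1) := by positivity
  refine ⟨(τ (E t)).toReal, 1 / ((t : ℝ) + 1), t + 1, 1, (1 / ((t : ℝ) + 1)) ^ (1 / ε),
    ENNReal.toReal_pos ht (measure_ne_top _ _), hη, by positivity, one_pos, by positivity, ?_⟩
  intro R hR
  have hcard : ⌊R ^ (-(0 : ℝ))⌋₊ = 1 := by simp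
  have hsub : Subsingleton (Fin ⌊R ^ (-(0 : ℝ))⌋₊) := by rw [hcard]; infer_instance
  refine ⟨fun _ _ => annulus u₀ t, fun _ => ?_, ?_⟩
  · refine ⟨fun _ => (isClosed_annulus u₀ t).measurableSet, fun _ x hx => hx.1,
      fun _ x hx => hx.2, fun i j hij => absurd (Subsingleton.elim i j) hij, fun z ρ J _ => ?_⟩
    refine le_max_of_le_left ?_
    exact_mod_cast Finset.card_le_one_of_subsingleton J
  · rw [ENNReal.ofReal_toReal (measure_ne_top _ _)]
    refine measure_mono fun b hb => Set.mem_iUnion.2 ⟨0, fun j => le_trans ?_ hb⟩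
    refine ENNReal.ofReal_le_ofReal ?_
    rw [zero_add]
    calc R ^ ε ≤ ((1 / ((t : ℝ) + 1)) ^ (1 / ε)) ^ ε :=
          Real.rpow_le_rpow hR.1.le hR.2.le hε.le
      _ = 1 / ((t : ℝ) + 1) := by
          rw [← Real.rpow_mul hη.le, one_div_mul_cancel hε.ne', Real.rpow_one]

/-- Blocks with uniformly controlled masses of balls, up to radius `1 / (t + 1)`. -/
def controlledBlocks (u₀ : U) (d δ : ℝ) (t : ℕ) : Set (Block U u₀) :=
  {b | ENNReal.ofReal (1 / ((t : ℝ) + 1)) ≤ b.meas (annulus u₀ t) ∧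
    ∀ x ∈ b.carrier, ∀ r ∈ Set.Ioo 0 (1 / ((t : ℝ) + 1)),
      r ^ (d + δ) ≤ b.meas.real (Metric.ball x r) ∧ b.meas.real (Metric.ball x r) ≤ r ^ (d - δ)}

/-- Almost every block is controlled for some `t`: the upper bound on balls forbids an atom at `u₀`,
so some annulus has mass. Countably many null sets cannot cover. -/
theorem HypH.exists_controlledBlocks_ne_zero {d : ℝ} {τ : Measure (Block U u₀)} (hτ : HypH d τ)
    [IsProbabilityMeasure τ] (hd : 0 < d) {δ : ℝ} (hδ : 0 < δ) (hδd : δ < d) :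
    ∃ t, τ (controlledBlocks u₀ d δ t) ≠ 0 := by
  obtain ⟨φ, -, -, hφ0, hφ⟩ := hτ.ball_of_pos hd
  obtain ⟨r₁, hr₁, hφr⟩ : ∃ r₁ > 0, ∀ r ∈ Set.Ioo (0 : ℝ) r₁, φ r < δ := by
    have := hφ0.eventually (eventually_lt_nhds hδ)
    obtain ⟨r₁, hr₁, h⟩ := mem_nhdsGT_iff_exists_Ioo_subset.1 this
    exact ⟨r₁, hr₁, fun r hr => h hr⟩
  have hcov : ∀ᵐ b ∂τ, b ∈ ⋃ t, controlledBlocks u₀ d δ t := by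
    filter_upwards [hφ] with b hb
    obtain ⟨r₀, hr₀, hb⟩ := hb
    have hctl : ∀ x ∈ b.carrier, ∀ r ∈ Set.Ioo 0 (min r₀ r₁),
        r ^ (d + δ) ≤ b.meas.real (Metric.ball x r) ∧
          b.meas.real (Metric.ball x r) ≤ r ^ (d - δ) := by
      intro x hx r hr
      have h1 := hb r ⟨hr.1.le, hr.2.trans_le (min_le_left _ _)⟩ x hx
      have h2 := hφr r ⟨hr.1, hr.2.trans_le (min_le_right _ _)⟩
      have h3 : r ≤ 1 := (hr.2.trans_le (min_le_left _ _)).le.trans hr₀.2.le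
      exact ⟨(Real.rpow_le_rpow_of_exponent_ge hr.1 h3 (by linarith)).trans h1.1,
        h1.2.trans (Real.rpow_le_rpow_of_exponent_ge hr.1 h3 (by linarith))⟩
    have hmin : 0 < min r₀ r₁ := lt_min hr₀.1 hr₁
    have hu : b.meas {u₀} = 0 := by
      have hle : ∀ r ∈ Set.Ioo 0 (min r₀ r₁), b.meas.real {u₀} ≤ r ^ (d - δ) := fun r hr =>
        (measureReal_mono (Set.singleton_subset_iff.2 (Metric.mem_ball_self hr.1))).trans
          (hctl u₀ b.2.1 r hr).2
      have hlim : Tendsto (fun r : ℝ => r ^ (d - δ)) (𝓝[>] 0) (𝓝 0) := by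
        have := (Real.continuousAt_rpow_const 0 (d - δ) (Or.inr (by linarith))).tendsto
        rw [Real.zero_rpow (by linarith)] at this
        exact this.mono_left nhdsWithin_le_nhds
      have h0 : b.meas.real {u₀} ≤ 0 := by
        refine ge_of_tendsto hlim ?_
        filter_upwards [Ioo_mem_nhdsGT hmin] with r hr using hle r hr
      exact (measureReal_eq_zero_iff).1 (le_antisymm h0 measureReal_nonneg)
    have hu' : b.meas {u₀}ᶜ ≠ 0 := by
      rw [measure_compl (measurableSet_singleton u₀) (measure_ne_top _ _), hu]
      simp
    obtain ⟨t, ht⟩ := exists_le_measure_annulus b.meas hu'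
    obtain ⟨s, hs⟩ := exists_nat_one_div_lt hmin
    refine Set.mem_iUnion.2 ⟨max s t, ht _ (le_max_right _ _), fun x hx r hr => ?_⟩
    refine hctl x hx r ⟨hr.1, hr.2.trans_le (le_trans ?_ hs.le)⟩
    have h1 : (s : ℝ) ≤ (max s t : ℕ) := Nat.cast_le.2 (le_max_left s t)
    exact one_div_le_one_div_of_le (by positivity) (by linarith)
  by_contra! h0
  have h1 := measure_eq_zero_iff_ae_notMem.1 (measure_iUnion_null h0)
  obtain ⟨b, hb1, hb2⟩ := (hcov.and h1).exists
  exact hb2 hb1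

theorem eventually_mul_rpow_lt {C s η : ℝ} (hs : 0 < s) (hη : 0 < η) :
    ∃ R₀ > 0, ∀ R ∈ Set.Ioo (0 : ℝ) R₀, C * R ^ s < η := by
  have h : Tendsto (fun R : ℝ => C * R ^ s) (𝓝[>] 0) (𝓝 0) := by
    have := (Real.continuousAt_rpow_const 0 s (Or.inr hs.le)).tendsto.const_mul C
    rw [Real.zero_rpow hs.ne', mul_zero] at this
    exact this.mono_left nhdsWithin_le_nhds
  obtain ⟨R₀, h0, h1⟩ := mem_nhdsGT_iff_exists_Ioo_subset.1 (h.eventually (eventually_lt_nhds hη))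
  exact ⟨R₀, h0, fun R hR => h1 hR⟩

/-- A controlled block contains about `R ^ (-(d - ε))` separated points of an annulus. Moving the
centres to a dense sequence leaves countably many deterministic cell families, so one sequence of
families serves all controlled blocks. -/
theorem HypH.exists_cells_of_pos [SecondCountableTopology U] {d : ℝ} {τ : Measure (Block U u₀)}
    (hτ : HypH d τ) [IsProbabilityMeasure τ] {ε : ℝ} (hε : 0 < ε) (hεd : ε < d) :
    ∃ p c M C R₀ : ℝ, 0 < p ∧ 0 < c ∧ 0 < M ∧ 0 < C ∧ 0 < R₀ ∧ ∀ R ∈ Set.Ioo 0 R₀,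
      ∃ S : ℕ → Fin ⌊R ^ (-(d - ε))⌋₊ → Set U,
        (∀ t, IsCellFamily u₀ c M C (d - ε) (d + ε) R (S t)) ∧
        ENNReal.ofReal p ≤
          τ (⋃ t, {b | ∀ j, ENNReal.ofReal (R ^ (d + ε)) ≤ b.meas (S t j)}) := by
  have hd : 0 < d := hε.trans hεd
  obtain ⟨t, ht⟩ := hτ.exists_controlledBlocks_ne_zero hd (half_pos hε) (by linarith)
  set η : ℝ := 1 / ((t : ℝ) + 1) with hη
  have hη0 : 0 < η := by positivity
  have hη1 : η ≤ 1 := by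
    rw [hη, div_le_one (by positivity)]
    have : (0 : ℝ) ≤ t := Nat.cast_nonneg t
    linarith
  obtain ⟨R₁, hR₁, h₁⟩ := eventually_mul_rpow_lt (C := 8 ^ (d - ε / 2)) (half_pos hε) hη0
  obtain ⟨R₂, hR₂, h₂⟩ := eventually_mul_rpow_lt (C := 2 ^ (d + ε / 2)) (half_pos hε) one_pos
  refine ⟨(τ (controlledBlocks u₀ d (ε / 2) t)).toReal, η / 2, (t + 1) + 1, (7 / η) ^ d,
    min (η / 8) (min R₁ R₂),
    ENNReal.toReal_pos ht (measure_ne_top _ _), by positivity, by positivity, by positivity,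
    lt_min (by positivity) (lt_min hR₁ hR₂), ?_⟩
  intro R hR
  have hR0 : 0 < R := hR.1
  have hRη : 8 * R < η := by have := hR.2.trans_le (min_le_left _ _); linarith
  have hRR₁ := h₁ R ⟨hR0, hR.2.trans_le ((min_le_right _ _).trans (min_le_left _ _))⟩
  have hRR₂ := h₂ R ⟨hR0, hR.2.trans_le ((min_le_right _ _).trans (min_le_right _ _))⟩
  set m := ⌊R ^ (-(d - ε))⌋₊ with hm
  have hmle : (m : ℝ) ≤ R ^ (-(d - ε)) := Nat.floor_le (Real.rpow_nonneg hR0.le _)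
  have : Nonempty U := ⟨u₀⟩
  let 𝒮 : Set (Fin m → Set U) :=
    {S | IsCellFamily u₀ (η / 2) ((t + 1) + 1) ((7 / η) ^ d) (d - ε) (d + ε) R S ∧
      S ∈ Set.range fun f : Fin m → ℕ => fun i => Metric.ball (TopologicalSpace.denseSeq U (f i)) R}
  have h𝒮 : 𝒮.Countable := (Set.countable_range _).mono fun S hS => hS.2
  rw [ENNReal.ofReal_toReal (measure_ne_top _ _)]
  suffices hsuff : τ (controlledBlocks u₀ d (ε / 2) t) ≤
      τ (⋃ S ∈ 𝒮, {b | ∀ j, ENNReal.ofReal (R ^ (d + ε)) ≤ b.meas (S j)}) by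
    obtain ⟨S, hS, h⟩ := exists_countable_seq h𝒮 (pos_iff_ne_zero.2 ht) hsuff
    exact ⟨S, fun t => (hS t).1, h⟩
  refine measure_mono fun b hb => ?_
  obtain ⟨hb1, hb2⟩ := hb
  set A := annulus u₀ t ∩ b.carrier with hA
  have hAm : ENNReal.ofReal η ≤ b.meas A := by rwa [hA, b.meas_inter_carrier]
  have hAball : ∀ x ∈ A, b.meas (Metric.ball x (8 * R)) ≤ ENNReal.ofReal ((8 * R) ^ (d - ε / 2)) := by
    intro x hx
    rw [← ofReal_measureReal]
    exact ENNReal.ofReal_le_ofReal (hb2 x hx.2 (8 * R) ⟨by linarith, hRη⟩).2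
  obtain ⟨x, hxA, hx⟩ := exists_separated_of_lt_measure b.meas A (8 * R) _ hAball m (by
    refine lt_of_lt_of_le ?_ hAm
    rw [← ENNReal.ofReal_natCast, ← ENNReal.ofReal_mul (Nat.cast_nonneg m)]
    refine (ENNReal.ofReal_lt_ofReal_iff hη0).2 (lt_of_le_of_lt ?_ hRR₁)
    rw [Real.mul_rpow (by norm_num) hR0.le]
    calc (m : ℝ) * (8 ^ (d - ε / 2) * R ^ (d - ε / 2))
        ≤ R ^ (-(d - ε)) * (8 ^ (d - ε / 2) * R ^ (d - ε / 2)) := by gcongr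
      _ = 8 ^ (d - ε / 2) * (R ^ (-(d - ε)) * R ^ (d - ε / 2)) := by ring
      _ = 8 ^ (d - ε / 2) * R ^ (ε / 2) := by rw [← Real.rpow_add hR0]; congr 2; ring)
  have hex : ∀ i, ∃ n, dist (x i) (TopologicalSpace.denseSeq U n) < R / 2 := fun i =>
    (TopologicalSpace.denseRange_denseSeq U).exists_dist_lt (x i) (half_pos hR0)
  choose f hf using hex
  refine Set.mem_iUnion₂.2 ⟨fun i => Metric.ball (TopologicalSpace.denseSeq U (f i)) R,
    ⟨?_, f, rfl⟩, fun j => ?_⟩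
  · exact isCellFamily_ball b.meas hε hεd hη0 hη1 hR0 (by linarith)
      (fun x hx r hr => hb2 x hx.2 r hr) (fun x hx => hx.1.1) (fun x hx => hx.1.2) hmle hxA hx hf
  · have h1 : Metric.ball (x j) (R / 2) ⊆ Metric.ball (TopologicalSpace.denseSeq U (f j)) R :=
      Metric.ball_subset_ball' (by have := hf j; linarith)
    refine le_trans ?_ (measure_mono h1)
    rw [← ofReal_measureReal]
    refine ENNReal.ofReal_le_ofReal (le_trans ?_ (hb2 _ (hxA j).2 (R / 2) ⟨by linarith, by linarith⟩).1)
    rw [Real.div_rpow hR0.le (by norm_num), le_div_iff₀ (by positivity)]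
    calc R ^ (d + ε) * 2 ^ (d + ε / 2) = R ^ (d + ε / 2) * (2 ^ (d + ε / 2) * R ^ (ε / 2)) := by
          rw [show d + ε = (d + ε / 2) + ε / 2 by ring, Real.rpow_add hR0]; ring
      _ ≤ R ^ (d + ε / 2) * 1 := by gcongr
      _ = R ^ (d + ε / 2) := mul_one _

theorem HypH.exists_cells [SecondCountableTopology U] {d : ℝ} (hd : 0 ≤ d)
    {τ : Measure (Block U u₀)} (hτ : HypH d τ) [IsProbabilityMeasure τ] {ε D₁ : ℝ} (hε : 0 < ε)
    (hD : d = 0 ∧ D₁ = 0 ∨ ε < d ∧ D₁ = d - ε) :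
    ∃ p c M C R₀ : ℝ, 0 < p ∧ 0 < c ∧ 0 < M ∧ 0 < C ∧ 0 < R₀ ∧ ∀ R ∈ Set.Ioo 0 R₀,
      ∃ S : ℕ → Fin ⌊R ^ (-D₁)⌋₊ → Set U,
        (∀ t, IsCellFamily u₀ c M C D₁ (d + ε) R (S t)) ∧
        ENNReal.ofReal p ≤
          τ (⋃ t, {b | ∀ j, ENNReal.ofReal (R ^ (d + ε)) ≤ b.meas (S t j)}) := by
  rcases hD with ⟨rfl, rfl⟩ | ⟨h, rfl⟩
  · exact hτ.exists_cells_of_eq_zero hε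
  · exact hτ.exists_cells_of_pos hε h

end ExistsCells

/-! ### Probability of missing a cell -/

section GraftLaw

variable {U : Type*} [MetricSpace U] [MeasurableSpace U] {u₀ : U}

theorem totalWeight_pos {w : ℕ → ℝ} (hw : ∀ n ≥ 1, 0 ≤ w n) (hw₁ : 0 < w 1) {n : ℕ} (hn : 1 ≤ n) :
    0 < totalWeight w n :=
  Finset.sum_pos' (fun k hk => hw k (Finset.mem_Icc.1 hk).1) ⟨1, Finset.mem_Icc.2 ⟨le_rfl, hn⟩, hw₁⟩

theorem isProbabilityMeasure_graftLaw {w : ℕ → ℝ} (hw : ∀ n ≥ 1, 0 ≤ w n) (hw₁ : 0 < w 1)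
    (B : ℕ → Block U u₀) {n : ℕ} (hn : 1 ≤ n) : IsProbabilityMeasure (graftLaw w B n) := by
  refine ⟨?_⟩
  have h : ∀ k, ((B k).meas.map fun x => (k, x)) Set.univ = 1 := fun k => by
    rw [Measure.map_apply measurable_prodMk_left MeasurableSet.univ, Set.preimage_univ,
      measure_univ]
  simp only [graftLaw, Measure.coe_finsetSum, Finset.sum_apply, Measure.smul_apply, h,
    smul_eq_mul, mul_one]
  rw [← ENNReal.ofReal_sum_of_nonneg, ← Finset.sum_div]
  · have := totalWeight_pos hw hw₁ hn
    rw [show ∑ k ∈ Finset.Icc 1 n, w k = totalWeight w n from rfl, div_self this.ne',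
      ENNReal.ofReal_one]
  · exact fun k hk => div_nonneg (hw k (Finset.mem_Icc.1 hk).1) (totalWeight_pos hw hw₁ hn).le

theorem graftLaw_compl_le {w : ℕ → ℝ} (hw : ∀ n ≥ 1, 0 ≤ w n) (hw₁ : 0 < w 1)
    (B : ℕ → Block U u₀) {i n : ℕ} (hi : 1 ≤ i) (hin : i ≤ n) {Y : Set U} (hY : MeasurableSet Y)
    {u v : ℝ} (hu0 : 0 ≤ u) (hu : u ≤ w i / totalWeight w n * v)
    (hv : ENNReal.ofReal v ≤ (B i).meas Y) :
    graftLaw w B n ({i} ×ˢ Y)ᶜ ≤ ENNReal.ofReal (1 - u) := by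
  have hprob := isProbabilityMeasure_graftLaw hw hw₁ B (hi.trans hin)
  have hm : MeasurableSet (({i} : Set ℕ) ×ˢ Y) := (measurableSet_singleton i).prod hY
  rw [measure_compl hm (measure_ne_top _ _), measure_univ, ENNReal.ofReal_sub _ hu0,
    ENNReal.ofReal_one]
  refine tsub_le_tsub_left ?_ _
  have h1 : ENNReal.ofReal (w i / totalWeight w n) * (B i).meas Y ≤
      graftLaw w B n ({i} ×ˢ Y) := by
    have h2 : ((B i).meas.map fun x => (i, x)) ({i} ×ˢ Y) = (B i).meas Y := by
      rw [Measure.map_apply measurable_prodMk_left hm]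
      congr 1
      ext x
      simp
    simp only [graftLaw, Measure.coe_finsetSum, Finset.sum_apply, Measure.smul_apply, smul_eq_mul]
    rw [← h2]
    exact Finset.single_le_sum (f := fun k => ENNReal.ofReal (w k / totalWeight w n) *
      ((B k).meas.map fun x => (k, x)) ({i} ×ˢ Y)) (fun k _ => zero_le)
      (Finset.mem_Icc.2 ⟨hi, hin⟩)
  refine le_trans ?_ h1
  calc ENNReal.ofReal u ≤ ENNReal.ofReal (w i / totalWeight w n * v) := ENNReal.ofReal_le_ofReal hu
    _ = ENNReal.ofReal (w i / totalWeight w n) * ENNReal.ofReal v :=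
        ENNReal.ofReal_mul (div_nonneg (hw i hi) (totalWeight_pos hw hw₁ (hi.trans hin)).le)
    _ ≤ _ := by gcongr

end GraftLaw

namespace IsGluingProcess

variable {U : Type*} [MetricSpace U] [MeasurableSpace U] [BorelSpace U] {u₀ : U}
  {Ω : Type*} [MeasurableSpace Ω] {P : Measure Ω}
  {τ : Measure (Block U u₀)} {w : ℕ → ℝ}
  {B : ℕ → Ω → Block U u₀} {K : ℕ → Ω → ℕ} {X : ℕ → Ω → U}

theorem isProbabilityMeasure [IsProbabilityMeasure P] (hglue : IsGluingProcess P τ w B K X) :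
    IsProbabilityMeasure τ := by
  rw [← hglue.block_law 1 le_rfl]
  exact Measure.isProbabilityMeasure_map (hglue.measurable_block 1 le_rfl).aemeasurable

theorem measurable_blocks (hglue : IsGluingProcess P τ w B K X) :
    Measurable fun ω => fun i => B (i + 1) ω :=
  measurable_pi_lambda _ fun i => hglue.measurable_block (i + 1) (by omega)

/-- The times outside `H` impose no constraint and contribute factors `1`. -/
theorem measure_graft_mem_eq (hglue : IsGluingProcess P τ w B K X) (hw : ∀ n ≥ 1, 0 ≤ w n)
    (hw₁ : 0 < w 1) {A : Set (ℕ → Block U u₀)} (hA : MeasurableSet A) {C : Set (ℕ × U)}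
    (hC : MeasurableSet C) (H : Finset ℕ) (hH : ∀ n ∈ H, 1 ≤ n) :
    P {ω | (fun i => B (i + 1) ω) ∈ A ∧ ∀ n ∈ H, (K n ω, X n ω) ∈ C} =
      ∫⁻ ω in {ω | (fun i => B (i + 1) ω) ∈ A}, ∏ n ∈ H, graftLaw w (fun k => B k ω) n C ∂P := by
  classical
  have hsub : H ⊆ Finset.Icc 1 (H.sup id) := fun n hn =>
    Finset.mem_Icc.2 ⟨hH n hn, Finset.le_sup (f := id) hn⟩
  have h := hglue.graft_law (H.sup id) A (fun n => if n ∈ H then C else Set.univ) hA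
    (fun n => by split_ifs; exacts [hC, MeasurableSet.univ])
  convert h using 2
  · ext ω
    refine and_congr_right fun _ => ⟨fun h n _ => ?_, fun h n hn => ?_⟩
    · split_ifs with hn
      exacts [h n hn, Set.mem_univ _]
    · have := h n (hsub hn)
      rwa [if_pos hn] at this
  · ext ω
    rw [← Finset.prod_subset hsub]
    · exact Finset.prod_congr rfl fun n hn => by rw [if_pos hn]
    · intro n hn hn'
      rw [if_neg hn']
      have := isProbabilityMeasure_graftLaw hw hw₁ (fun k => B k ω) (Finset.mem_Icc.1 hn).1
      exact measure_univ

/-- The conditional law handles constraints at deterministic times, while here time `n` is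
constrained only if block `n + 1` is in `E`. The induction splits on this event, moving `n` into `H`
when it holds and dropping it otherwise. -/
theorem measure_graft_mem_of_good_le (hglue : IsGluingProcess P τ w B K X)
    (hw : ∀ n ≥ 1, 0 ≤ w n) (hw₁ : 0 < w 1) {C : Set (ℕ × U)} (hC : MeasurableSet C)
    {E : Set (Block U u₀)} (hE : MeasurableSet E) {κ : ℝ≥0∞} (G : Finset ℕ) :
    ∀ (A : Set (ℕ → Block U u₀)) (H : Finset ℕ), MeasurableSet A → Disjoint G H →
      (∀ n ∈ G, 1 ≤ n) → (∀ n ∈ H, 1 ≤ n) →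
      (∀ ω, (fun i => B (i + 1) ω) ∈ A → ∀ n ∈ G ∪ H, graftLaw w (fun k => B k ω) n C ≤ κ) →
      P {ω | (fun i => B (i + 1) ω) ∈ A ∧ (∀ n ∈ H, (K n ω, X n ω) ∈ C) ∧
        ∀ n ∈ G, B (n + 1) ω ∈ E → (K n ω, X n ω) ∈ C} ≤
      κ ^ H.card * ∫⁻ ω in {ω | (fun i => B (i + 1) ω) ∈ A},
        ∏ n ∈ G, (E.indicator (fun _ => κ) (B (n + 1) ω) +
          Eᶜ.indicator (fun _ => 1) (B (n + 1) ω)) ∂P := by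
  classical
  induction G using Finset.induction_on with
  | empty =>
    intro A H hA _ _ hH hκ
    have h1 := hglue.measure_graft_mem_eq hw hw₁ hA hC H hH
    simp only [Finset.notMem_empty, false_imp_iff, implies_true, and_true, Finset.prod_empty]
    rw [h1]
    calc _ ≤ ∫⁻ ω in {ω | (fun i => B (i + 1) ω) ∈ A}, κ ^ H.card ∂P := by
          refine setLIntegral_mono' (hglue.measurable_blocks hA) fun ω hω => ?_
          exact Finset.prod_le_pow_card _ _ _ fun n hn => hκ ω hω n (by simp [hn])
      _ = _ := by simp
  | insert n G hnG ih =>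
    intro A H hA hdisj hG hH hκ
    have hnH : n ∉ H := fun h => Finset.disjoint_left.1 hdisj (Finset.mem_insert_self n G) h
    have hGH : Disjoint G H := hdisj.mono_left (Finset.subset_insert n G)
    have hproj : MeasurableSet {b : ℕ → Block U u₀ | b n ∈ E} := measurable_pi_apply n hE
    have h1 := ih (A ∩ {b | b n ∈ E}) (insert n H) (hA.inter hproj)
      (Finset.disjoint_insert_right.2 ⟨hnG, hGH⟩) (fun k hk => hG k (Finset.mem_insert_of_mem hk))
      (fun k hk => by
        rcases Finset.mem_insert.1 hk with rfl | hk
        exacts [hG _ (Finset.mem_insert_self _ _), hH k hk])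
      (fun ω hω k hk => hκ ω hω.1 k (by
        simp only [Finset.mem_union, Finset.mem_insert] at hk ⊢; tauto))
    have h2 := ih (A ∩ {b | b n ∈ E}ᶜ) H (hA.inter hproj.compl) hGH
      (fun k hk => hG k (Finset.mem_insert_of_mem hk)) hH
      (fun ω hω k hk => hκ ω hω.1 k (by
        simp only [Finset.mem_union, Finset.mem_insert] at hk ⊢; tauto))
    have hA' := hglue.measurable_blocks hA
    have hE' : MeasurableSet {ω | B (n + 1) ω ∈ E} := hglue.measurable_block (n + 1) (by omega) hE
    set f : Ω → ℝ≥0∞ := fun ω => ∏ n ∈ G, (E.indicator (fun _ => κ) (B (n + 1) ω) +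
          Eᶜ.indicator (fun _ => 1) (B (n + 1) ω)) with hf
    have hfm : Measurable f := Finset.measurable_prod _ fun k _ =>
      (((measurable_const.indicator hE).add (measurable_const.indicator hE.compl))).comp
        (hglue.measurable_block (k + 1) (by omega))
    calc _ ≤ _ := measure_mono (t :=
            {ω | (fun i => B (i + 1) ω) ∈ A ∩ {b | b n ∈ E} ∧
              (∀ k ∈ insert n H, (K k ω, X k ω) ∈ C) ∧
              ∀ k ∈ G, B (k + 1) ω ∈ E → (K k ω, X k ω) ∈ C} ∪
            {ω | (fun i => B (i + 1) ω) ∈ A ∩ {b | b n ∈ E}ᶜ ∧ (∀ k ∈ H, (K k ω, X k ω) ∈ C) ∧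
              ∀ k ∈ G, B (k + 1) ω ∈ E → (K k ω, X k ω) ∈ C}) (by
          rintro ω ⟨ha, hb, hc⟩
          by_cases hω : B (n + 1) ω ∈ E
          · refine Or.inl ⟨⟨ha, hω⟩, fun k hk => ?_, fun k hk => hc k (Finset.mem_insert_of_mem hk)⟩
            rcases Finset.mem_insert.1 hk with rfl | hk
            exacts [hc _ (Finset.mem_insert_self _ _) hω, hb k hk]
          · exact Or.inr ⟨⟨ha, hω⟩, hb, fun k hk => hc k (Finset.mem_insert_of_mem hk)⟩)
      _ ≤ _ := measure_union_le _ _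
      _ ≤ _ := add_le_add h1 h2
      _ = κ ^ H.card * ∫⁻ ω in {ω | (fun i => B (i + 1) ω) ∈ A},
          (E.indicator (fun _ => κ) (B (n + 1) ω) + Eᶜ.indicator (fun _ => 1) (B (n + 1) ω)) *
            f ω ∂P := by
        rw [Finset.card_insert_of_notMem hnH, pow_succ, mul_assoc, ← mul_add]
        congr 1
        rw [← lintegral_const_mul κ hfm]
        refine Eq.trans ?_ (lintegral_inter_add_sdiff _ _ hE')
        congr 1
        · refine setLIntegral_congr_fun (hA'.inter hE') fun ω hω => ?_
          have : B (n + 1) ω ∈ E := hω.2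
          simp [this]
        · refine setLIntegral_congr_fun (hA'.diff hE') fun ω hω => ?_
          have : B (n + 1) ω ∉ E := hω.2
          simp [this, hf]
      _ = _ := by simp only [Finset.prod_insert hnG, hf]

variable [IsProbabilityMeasure P]

/-- The probability that none of the blocks `n + 1`, `n ∈ g`, is a block of `E` grafted on the
block `i` at a point of `Y`. -/
theorem measure_no_graft_le (hglue : IsGluingProcess P τ w B K X) (hw : ∀ n ≥ 1, 0 ≤ w n)
    (hw₁ : 0 < w 1) {i : ℕ} (hi : 1 ≤ i) {g : Finset ℕ} (hg : ∀ n ∈ g, i ≤ n)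
    {E F : Set (Block U u₀)} (hE : MeasurableSet E) (hF : MeasurableSet F) {Y : Set U}
    (hY : MeasurableSet Y) {p u v : ℝ} (hp : ENNReal.ofReal p ≤ τ E) (hu0 : 0 ≤ u) (hu1 : u ≤ 1)
    (hu : ∀ n ∈ g, u ≤ w i / totalWeight w n * v) (hv : ∀ b ∈ F, ENNReal.ofReal v ≤ b.meas Y) :
    P {ω | B i ω ∈ F ∧ ∀ n ∈ g, ¬ (B (n + 1) ω ∈ E ∧ K n ω = i ∧ X n ω ∈ Y)} ≤
      τ F * ENNReal.ofReal (Real.exp (-(p * u * g.card))) := by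
  classical
  have hτ := hglue.isProbabilityMeasure
  obtain ⟨i, rfl⟩ : ∃ j, i = j + 1 := ⟨i - 1, by omega⟩
  set κ := ENNReal.ofReal (1 - u) with hκ
  set C : Set (ℕ × U) := ({i + 1} ×ˢ Y)ᶜ with hCdef
  have hC : MeasurableSet C := ((measurableSet_singleton _).prod hY).compl
  set A : Set (ℕ → Block U u₀) := {b | b i ∈ F} with hAdef
  have hA : MeasurableSet A := measurable_pi_apply i hF
  have hig : i ∉ g := fun h => by have := hg i h; omega
  have h1 := hglue.measure_graft_mem_of_good_le hw hw₁ hC hE (κ := κ) g A ∅ hA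
    (Finset.disjoint_empty_right _) (fun n hn => hi.trans (hg n hn)) (by simp)
    (fun ω hω n hn => by
      rw [Finset.union_empty] at hn
      exact graftLaw_compl_le hw hw₁ _ hi (hg n hn) hY hu0 (hu n hn) (hv _ hω))
  have hset : {ω | B (i + 1) ω ∈ F ∧ ∀ n ∈ g, ¬ (B (n + 1) ω ∈ E ∧ K n ω = i + 1 ∧ X n ω ∈ Y)} ⊆
      {ω | (fun i => B (i + 1) ω) ∈ A ∧ (∀ n ∈ (∅ : Finset ℕ), (K n ω, X n ω) ∈ C) ∧
        ∀ n ∈ g, B (n + 1) ω ∈ E → (K n ω, X n ω) ∈ C} := by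
    rintro ω ⟨ha, hb⟩
    refine ⟨ha, by simp, fun n hn hnE hmem => hb n hn ⟨hnE, ?_⟩⟩
    simpa using hmem
  refine (measure_mono hset).trans (h1.trans ?_)
  rw [Finset.card_empty, pow_zero, one_mul]
  set f : Block U u₀ → ℝ≥0∞ := fun b => E.indicator (fun _ => κ) b + Eᶜ.indicator (fun _ => 1) b
    with hf
  have hfm : Measurable f := (measurable_const.indicator hE).add (measurable_const.indicator hE.compl)
  -- The parent, at shifted index `i`, is distinct from all candidate children, so its constraint is
  -- one more independent factor.
  set h : ℕ → Block U u₀ → ℝ≥0∞ := fun n => if n = i then F.indicator (fun _ => 1) else f with hh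
  have hhm : ∀ n, Measurable (h n) := fun n => by
    simp only [hh]
    split_ifs
    exacts [measurable_const.indicator hF, hfm]
  have hA' : MeasurableSet {ω | (fun i => B (i + 1) ω) ∈ A} := hglue.measurable_blocks hA
  have h2 : ∫⁻ ω in {ω | (fun i => B (i + 1) ω) ∈ A}, ∏ n ∈ g, f (B (n + 1) ω) ∂P =
      ∫⁻ ω, ∏ n ∈ insert i g, h n (B (n + 1) ω) ∂P := by
    rw [← lintegral_indicator hA']
    refine lintegral_congr fun ω => ?_
    rw [Finset.prod_insert hig]
    have h3 : ∏ n ∈ g, h n (B (n + 1) ω) = ∏ n ∈ g, f (B (n + 1) ω) :=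
      Finset.prod_congr rfl fun n hn => by
        simp only [hh]
        rw [if_neg (by rintro rfl; exact hig hn)]
    rw [h3]
    by_cases hω : B (i + 1) ω ∈ F
    · rw [Set.indicator_of_mem (show ω ∈ {ω | (fun i => B (i + 1) ω) ∈ A} from hω)]
      simp [hh, hω]
    · rw [Set.indicator_of_notMem (show ω ∉ {ω | (fun i => B (i + 1) ω) ∈ A} from hω)]
      simp [hh, hω]
  have h4 : ∀ n, ∫⁻ ω, h n (B (n + 1) ω) ∂P = ∫⁻ b, h n b ∂τ := fun n => by
    rw [← hglue.block_law (n + 1) (by omega),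
      lintegral_map (hhm n) (hglue.measurable_block (n + 1) (by omega))]
  -- The mean is `1 - u * τ E ≤ 1 - p * u`.
  have h5 : ∫⁻ b, f b ∂τ ≤ ENNReal.ofReal (Real.exp (-(p * u))) := by
    simp only [hf]
    rw [lintegral_add_left (measurable_const.indicator hE), lintegral_indicator_const hE,
      lintegral_indicator_const hE.compl, prob_compl_eq_one_sub hE, one_mul,
      ← ofReal_measureReal (μ := τ) (s := E)]
    have he1 : τ.real E ≤ 1 := measureReal_le_one
    have he : p ≤ τ.real E :=
      (ENNReal.ofReal_le_iff_le_toReal (measure_ne_top _ _)).1 hp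
    rw [hκ, ← ENNReal.ofReal_one, ← ENNReal.ofReal_sub _ measureReal_nonneg,
      ← ENNReal.ofReal_mul (by linarith),
      ← ENNReal.ofReal_add (mul_nonneg (by linarith) measureReal_nonneg) (by linarith)]
    refine ENNReal.ofReal_le_ofReal ?_
    have h6 := Real.add_one_le_exp (-(p * u))
    nlinarith [mul_le_mul_of_nonneg_right he hu0]
  change ∫⁻ ω in {ω | (fun i => B (i + 1) ω) ∈ A}, ∏ n ∈ g, f (B (n + 1) ω) ∂P ≤ _
  rw [h2, lintegral_prod_eq_prod_lintegral_of_indepFun (insert i g) (fun n ω => h n (B (n + 1) ω))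
    (hglue.block_indep.comp h hhm) (fun n => (hhm n).comp (hglue.measurable_block (n + 1) (by omega))),
    Finset.prod_insert hig, h4]
  refine mul_le_mul' (le_of_eq ?_) ?_
  · simp [hh, lintegral_indicator_const hF]
  · calc ∏ n ∈ g, ∫⁻ ω, h n (B (n + 1) ω) ∂P
        ≤ ENNReal.ofReal (Real.exp (-(p * u))) ^ g.card := by
          refine Finset.prod_le_pow_card _ _ _ fun n hn => ?_
          rw [h4]
          simp only [hh]
          rw [if_neg (by rintro rfl; exact hig hn)]
          exact h5
      _ = _ := by
          rw [← ENNReal.ofReal_pow (Real.exp_pos _).le, ← Real.exp_nat_mul]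
          congr 2
          ring

/-- The probability that a block `i` with a good cell family misses a child in one of its cells. -/
theorem measure_exists_cell_no_graft_le (hglue : IsGluingProcess P τ w B K X)
    (hw : ∀ n ≥ 1, 0 ≤ w n) (hw₁ : 0 < w 1) {i : ℕ} (hi : 1 ≤ i) {g : Finset ℕ}
    (hg : ∀ n ∈ g, i ≤ n) {E : Set (Block U u₀)} (hE : MeasurableSet E) {m : ℕ}
    {S : ℕ → Fin m → Set U} (hS : ∀ t j, MeasurableSet (S t j))
    {p u v : ℝ} (hp : ENNReal.ofReal p ≤ τ E) (hu0 : 0 ≤ u) (hu1 : u ≤ 1)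
    (hu : ∀ n ∈ g, u ≤ w i / totalWeight w n * v) :
    P {ω | B i ω ∈ ⋃ t, {b | ∀ j, ENNReal.ofReal v ≤ b.meas (S t j)} ∧
        ∀ t, ∃ j, ∀ n ∈ g, ¬ (B (n + 1) ω ∈ E ∧ K n ω = i ∧ X n ω ∈ S t j)} ≤
      ENNReal.ofReal (m * Real.exp (-(p * u * g.card))) := by
  have hτ := hglue.isProbabilityMeasure
  set F : ℕ → Set (Block U u₀) := fun t => {b | ∀ j, ENNReal.ofReal v ≤ b.meas (S t j)} with hFdef
  have hF : ∀ t, MeasurableSet (F t) := fun t => by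
    have : F t = ⋂ j, {b | ENNReal.ofReal v ≤ b.meas (S t j)} := by
      ext b
      simp [hFdef]
    rw [this]
    exact MeasurableSet.iInter fun j =>
      measurableSet_le measurable_const (Block.measurable_meas_apply (hS t j))
  -- Each block is assigned to the first family that suits it: the probabilities then sum to at most
  -- `1`, whereas a union bound over all `t` could diverge.
  have hF' : ∀ t, MeasurableSet (disjointed F t) := MeasurableSet.disjointed hF
  set q := ENNReal.ofReal (Real.exp (-(p * u * g.card))) with hq
  calc _ ≤ P (⋃ t, ⋃ j : Fin m, {ω | B i ω ∈ disjointed F t ∧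
          ∀ n ∈ g, ¬ (B (n + 1) ω ∈ E ∧ K n ω = i ∧ X n ω ∈ S t j)}) := by
        refine measure_mono ?_
        rintro ω ⟨h1, h2⟩
        rw [← iUnion_disjointed] at h1
        obtain ⟨t, ht⟩ := Set.mem_iUnion.1 h1
        obtain ⟨j, hj⟩ := h2 t
        exact Set.mem_iUnion.2 ⟨t, Set.mem_iUnion.2 ⟨j, ht, hj⟩⟩
    _ ≤ ∑' t, ∑' j : Fin m, P {ω | B i ω ∈ disjointed F t ∧
          ∀ n ∈ g, ¬ (B (n + 1) ω ∈ E ∧ K n ω = i ∧ X n ω ∈ S t j)} :=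
        (measure_iUnion_le _).trans (ENNReal.tsum_le_tsum fun t => measure_iUnion_le _)
    _ ≤ ∑' t, ∑' _ : Fin m, τ (disjointed F t) * q :=
        ENNReal.tsum_le_tsum fun t => ENNReal.tsum_le_tsum fun j =>
          hglue.measure_no_graft_le hw hw₁ hi hg hE (hF' t) (hS t j) hp hu0 hu1 hu
            fun b hb => disjointed_subset F t hb j
    _ = m * ((∑' t, τ (disjointed F t)) * q) := by
        simp only [tsum_fintype, Finset.sum_const, Finset.card_univ, Fintype.card_fin, nsmul_eq_mul]
        rw [ENNReal.tsum_mul_left, ENNReal.tsum_mul_right]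
    _ ≤ m * (1 * q) := by
        rw [← measure_iUnion (disjoint_disjointed F) hF']
        gcongr
        exact prob_le_one
    _ = _ := by
        rw [one_mul, hq, ENNReal.ofReal_mul (Nat.cast_nonneg m), ENNReal.ofReal_natCast]

theorem measure_forall_notMem_le (hglue : IsGluingProcess P τ w B K X) {E : Set (Block U u₀)}
    (hE : MeasurableSet E) {p : ℝ} (hp : ENNReal.ofReal p ≤ τ E) {G : Finset ℕ}
    (hG : ∀ i ∈ G, 1 ≤ i) :
    P {ω | ∀ i ∈ G, B i ω ∉ E} ≤ ENNReal.ofReal (Real.exp (-(p * G.card))) := by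
  classical
  have hτ := hglue.isProbabilityMeasure
  have hinj : Set.InjOn (fun i => i - 1) (G : Set ℕ) := fun i hi j hj h => by
    have := hG i hi
    have := hG j hj
    simp only at h
    omega
  have h1 := hglue.block_indep.measure_inter_preimage_eq_mul (S := G.image fun i => i - 1)
    (sets := fun _ => Eᶜ) fun _ _ => hE.compl
  have h2 : {ω | ∀ i ∈ G, B i ω ∉ E} ⊆
      ⋂ i ∈ G.image fun i => i - 1, (fun ω => B (i + 1) ω) ⁻¹' Eᶜ := by
    intro ω hω
    refine Set.mem_iInter₂.2 fun j hj => ?_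
    obtain ⟨i, hi, rfl⟩ := Finset.mem_image.1 hj
    have h3 := hω i hi
    have h4 := hG i hi
    simp only [Set.mem_preimage, Nat.sub_add_cancel h4]
    exact h3
  refine (measure_mono h2).trans (h1.le.trans ?_)
  calc ∏ i ∈ G.image fun i => i - 1, P ((fun ω => B (i + 1) ω) ⁻¹' Eᶜ)
      ≤ ENNReal.ofReal (Real.exp (-p)) ^ (G.image fun i => i - 1).card := by
        refine Finset.prod_le_pow_card _ _ _ fun j _ => ?_
        rw [← Measure.map_apply (hglue.measurable_block (j + 1) (by omega)) hE.compl,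
          hglue.block_law (j + 1) (by omega), prob_compl_eq_one_sub hE,
          ← ofReal_measureReal (μ := τ) (s := E), ← ENNReal.ofReal_one,
          ← ENNReal.ofReal_sub _ measureReal_nonneg]
        refine ENNReal.ofReal_le_ofReal ?_
        have he : p ≤ τ.real E := (ENNReal.ofReal_le_iff_le_toReal (measure_ne_top _ _)).1 hp
        have := Real.add_one_le_exp (-p)
        linarith
    _ = _ := by
        rw [Finset.card_image_of_injOn hinj, ← ENNReal.ofReal_pow (Real.exp_pos _).le,
          ← Real.exp_nat_mul]
        congr 2
        ring

end IsGluingProcess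

/-! ### Construction of the tree -/

theorem exists_disjoint_subfamilies (s : Finset ℕ) (q h : ℕ) (hqh : q * h ≤ s.card) :
    ∃ g : Fin q → Finset ℕ, (∀ l, g l ⊆ s) ∧ (∀ l, (g l).card = h) ∧
      Pairwise fun l l' => Disjoint (g l) (g l') := by
  induction q generalizing s with
  | zero => exact ⟨Fin.elim0, fun l => l.elim0, fun l => l.elim0, fun l => l.elim0⟩
  | succ q ih =>
    have h1 : h ≤ s.card := by nlinarith
    obtain ⟨t, hts, ht⟩ := Finset.exists_subset_card_eq h1
    obtain ⟨g, hg1, hg2, hg3⟩ := ih (s \ t) (by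
      rw [Finset.card_sdiff_of_subset hts, ht]
      have : (q + 1) * h = q * h + h := by ring
      omega)
    refine ⟨Fin.cons t g, fun l => ?_, fun l => ?_, fun l l' hl => ?_⟩
    · refine Fin.cases ?_ (fun l => ?_) l
      · simpa using hts
      · simpa using (hg1 l).trans Finset.sdiff_subset
    · refine Fin.cases ?_ (fun l => ?_) l
      · simpa using ht
      · simpa using hg2 l
    · have h0 : ∀ l, Disjoint t (g l) := fun l =>
        Finset.disjoint_of_subset_right (hg1 l) Finset.disjoint_sdiff
      induction l using Fin.cases with
      | zero =>
        induction l' using Fin.cases with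
        | zero => exact absurd rfl hl
        | succ l' => simpa using h0 l'
      | succ l =>
        induction l' using Fin.cases with
        | zero => simpa using (h0 l).symm
        | succ l' => simpa using hg3 fun h => hl (congrArg Fin.succ h)

section CellBlocks

variable {U : Type*} [MetricSpace U] [MeasurableSpace U] {u₀ : U}

/-- The blocks that give mass at least `v` to each cell of one of the families `S t`. -/
def cellBlocks (u₀ : U) {m : ℕ} (v : ℝ) (S : ℕ → Fin m → Set U) : Set (Block U u₀) :=
  ⋃ t, {b | ∀ j, ENNReal.ofReal v ≤ b.meas (S t j)}

theorem measurableSet_cellBlocks [BorelSpace U] {m : ℕ} (v : ℝ) {S : ℕ → Fin m → Set U}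
    (hS : ∀ t j, MeasurableSet (S t j)) : MeasurableSet (cellBlocks u₀ v S) := by
  refine MeasurableSet.iUnion fun t => ?_
  rw [Set.ofPred_forall]
  exact MeasurableSet.iInter fun j =>
    measurableSet_le measurable_const (Block.measurable_meas_apply (hS t j))

variable {Ω : Type*}

/-- The event that no block with index in `G` lies in `cellBlocks u₀ v S`, or that one of them
misses, for some `l`, a child in one of its cells, among the blocks `n + 1` in `E` with
`n ∈ g l`. -/
def badLevel (B : ℕ → Ω → Block U u₀) (K : ℕ → Ω → ℕ) (X : ℕ → Ω → U) (G : Finset ℕ) {m q : ℕ}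
    (v : ℝ) (S : ℕ → Fin m → Set U) (g : Fin q → Finset ℕ) (E : Set (Block U u₀)) : Set Ω :=
  {ω | ∀ i ∈ G, B i ω ∉ cellBlocks u₀ v S} ∪
    ⋃ i ∈ G, ⋃ l, {ω | B i ω ∈ cellBlocks u₀ v S ∧
      ∀ t, ∃ j, ∀ n ∈ g l, ¬ (B (n + 1) ω ∈ E ∧ K n ω = i ∧ X n ω ∈ S t j)}

theorem IsGluingProcess.measure_badLevel_le [BorelSpace U] [MeasurableSpace Ω] {P : Measure Ω}
    [IsProbabilityMeasure P] {τ : Measure (Block U u₀)} {w : ℕ → ℝ} {B : ℕ → Ω → Block U u₀}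
    {K : ℕ → Ω → ℕ} {X : ℕ → Ω → U} (hglue : IsGluingProcess P τ w B K X)
    (hw : ∀ n ≥ 1, 0 ≤ w n) (hw₁ : 0 < w 1) {G : Finset ℕ} (hG : ∀ i ∈ G, 1 ≤ i) {m q h : ℕ}
    {v : ℝ} {S : ℕ → Fin m → Set U} (hS : ∀ t j, MeasurableSet (S t j)) {g : Fin q → Finset ℕ}
    (hg : ∀ l, ∀ n ∈ g l, ∀ i ∈ G, i ≤ n) (hcard : ∀ l, (g l).card = h) {E : Set (Block U u₀)}
    (hE : MeasurableSet E) {p u : ℝ} (hp : ENNReal.ofReal p ≤ τ (cellBlocks u₀ v S))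
    (hpE : ENNReal.ofReal p ≤ τ E) (hu0 : 0 ≤ u) (hu1 : u ≤ 1)
    (hu : ∀ i ∈ G, ∀ l, ∀ n ∈ g l, u ≤ w i / totalWeight w n * v) :
    P (badLevel B K X G v S g E) ≤ ENNReal.ofReal
      (Real.exp (-(p * G.card)) + G.card * (q * (m * Real.exp (-(p * u * h))))) := by
  rw [ENNReal.ofReal_add (Real.exp_pos _).le (by positivity)]
  refine (measure_union_le _ _).trans (add_le_add
    (hglue.measure_forall_notMem_le (measurableSet_cellBlocks v hS) hp hG) ?_)
  rw [ENNReal.ofReal_mul (Nat.cast_nonneg _), ENNReal.ofReal_mul (Nat.cast_nonneg _),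
    ENNReal.ofReal_natCast, ENNReal.ofReal_natCast, ← nsmul_eq_mul]
  refine (measure_biUnion_finset_le G _).trans (Finset.sum_le_card_nsmul _ _ _ fun i hi => ?_)
  refine (measure_iUnion_fintype_le _ _).trans ((Finset.sum_le_card_nsmul _ _ _ fun l _ =>
    ?_).trans_eq (by rw [Finset.card_univ, Fintype.card_fin, nsmul_eq_mul]))
  have h1 := hglue.measure_exists_cell_no_graft_le hw hw₁ (hG i hi)
    (fun n hn => hg l n hn i hi) hE hS hpE hu0 hu1 (hu i hi l)
  rw [hcard] at h1
  exact h1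

/-- This step is deterministic: children are coded by a group and a cell. The family `t` may depend
on the parent and on the group, which is harmless since `spread` is used one group at a time. -/
theorem exists_blockTree (B : ℕ → Block U u₀) {K : ℕ → ℕ} {X : ℕ → U} {lam : ℕ → ℝ}
    {c M C D₁ D₂ : ℝ} {l b R v : ℕ → ℝ} {G : ℕ → Finset ℕ} {m q : ℕ → ℕ}
    (hm : ∀ k, 0 < m k) (hq : ∀ k, 0 < q k)
    {S : (k : ℕ) → ℕ → Fin (m k) → Set U}
    (hS : ∀ k t, IsCellFamily u₀ c M C D₁ D₂ (R k) (S k t))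
    {g : (k : ℕ) → Fin (q k) → Finset ℕ}
    (hgG : ∀ k j, ∀ n ∈ g k j, n + 1 ∈ G (k + 1))
    (hgdisj : ∀ k, Pairwise fun j j' => Disjoint (g k j) (g k j'))
    (hG : ∀ k, ∀ i ∈ G k, 1 ≤ i) (hGlt : ∀ k, ∀ i ∈ G k, ∀ j ∈ G (k + 1), i < j)
    (hl : ∀ k, ∀ i ∈ G k, l k ≤ lam i) (hlam : ∀ k, ∀ i ∈ G k, 0 ≤ lam i)
    (hb : ∀ k, ∀ i ∈ G k, lam i * M ≤ b k)
    (hroot : ∃ i ∈ G 0, B i ∈ cellBlocks u₀ (v 0) (S 0))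
    (hchild : ∀ k, ∀ i ∈ G k, B i ∈ cellBlocks u₀ (v k) (S k) → ∀ j, ∃ t, ∀ a, ∃ n ∈ g k j,
      B (n + 1) ∈ cellBlocks u₀ (v (k + 1)) (S (k + 1)) ∧ K n = i ∧ X n ∈ S k t a) :
    ∃ T : BlockTree u₀ lam K X c l b
      (fun k ρ => q k * max 1 (C * R k ^ (-D₂) * ρ ^ D₁)), ∀ k, T.size k = q k * m k := by
  classical
  set V : ℕ → Set ℕ := fun k => {i | i ∈ G k ∧ B i ∈ cellBlocks u₀ (v k) (S k)} with hV
  have hchild' : ∀ k i, ∃ (t : Fin (q k) → ℕ) (n : Fin (q k) → Fin (m k) → ℕ), i ∈ V k →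
      ∀ j a, n j a ∈ g k j ∧ B (n j a + 1) ∈ cellBlocks u₀ (v (k + 1)) (S (k + 1)) ∧
        K (n j a) = i ∧ X (n j a) ∈ S k (t j) a := by
    intro k i
    by_cases hi : i ∈ V k
    · choose t ht using hchild k i hi.1 hi.2
      choose n hn using ht
      exact ⟨t, n, fun _ => hn⟩
    · exact ⟨fun _ => 0, fun _ _ => 0, fun h => absurd h hi⟩
  choose t n hn using hchild'
  obtain ⟨i₀, hi₀⟩ := hroot
  refine ⟨{
    size := fun k => q k * m k
    size_pos := fun k => Nat.mul_pos (hq k) (hm k)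
    nodes := V
    root := i₀
    child := fun k i a => n k i (finProdFinEquiv.symm a).1 (finProdFinEquiv.symm a).2 + 1
    root_mem := hi₀
    child_mem := fun k i hi a =>
      ⟨hgG k _ _ (hn k i hi _ _).1, (hn k i hi _ _).2.1⟩
    one_le := fun k i hi => hG k i hi.1
    lt_of_mem := fun k i hi j hj => hGlt k i hi.1 j hj.1
    parent := fun k i hi a => (hn k i hi _ _).2.2.1
    far := fun k i hi a => (hS k _).far _ _ (hn k i hi _ _).2.2.2
    bounded := fun k i hi a => (mul_le_mul_of_nonneg_left
      ((hS k _).bounded _ _ (hn k i hi _ _).2.2.2) (hlam k i hi.1)).trans (hb k i hi.1)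
    injective := ?_
    le_lam := fun k i hi => hl k i hi.1
    spread := ?_ }, fun k => rfl⟩
  -- A child determines its group because the groups are disjoint, then its cell because the cells
  -- are disjoint.
  · intro k i hi a a' haa
    have haa := Nat.succ_injective haa
    refine finProdFinEquiv.symm.injective ?_
    generalize finProdFinEquiv.symm a = p at haa ⊢
    generalize finProdFinEquiv.symm a' = p' at haa ⊢
    have h1 := hn k i hi p.1 p.2
    have h2 := hn k i hi p'.1 p'.2
    rw [← haa] at h2
    have h3 : p.1 = p'.1 := by
      by_contra hne
      exact Finset.disjoint_left.1 (hgdisj k hne) h1.1 h2.1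
    have h4 : p.2 = p'.2 := by
      by_contra hne
      rw [← h3] at h2
      exact Set.disjoint_left.1 ((hS k _).disjoint hne) h1.2.2.2 h2.2.2.2
    exact Prod.ext h3 h4
  · intro k i hi z ρ
    simp only [Nat.add_sub_cancel]
    have h1 : ∀ j, ((Finset.univ.filter fun a => dist (X (n k i j a)) z ≤ ρ).card : ℝ) ≤
        max 1 (C * R k ^ (-D₂) * ρ ^ D₁) := fun j =>
      (hS k (t k i j)).spread z ρ _ fun a ha =>
        ⟨_, (hn k i hi j a).2.2.2, (Finset.mem_filter.1 ha).2⟩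
    have h2 : (Finset.univ.filter fun a : Fin (q k * m k) =>
        dist (X (n k i (finProdFinEquiv.symm a).1 (finProdFinEquiv.symm a).2)) z ≤ ρ).card =
        ∑ j, (Finset.univ.filter fun a => dist (X (n k i j a)) z ≤ ρ).card := by
      simp only [Finset.card_filter]
      rw [← Finset.sum_product' (Finset.univ) Finset.univ
        (fun j a => if dist (X (n k i j a)) z ≤ ρ then 1 else 0), Finset.univ_product_univ]
      exact Equiv.sum_comp finProdFinEquiv.symm
        (fun p : Fin (q k) × Fin (m k) => if dist (X (n k i p.1 p.2)) z ≤ ρ then 1 else 0)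
    rw [h2, Nat.cast_sum]
    refine (Finset.sum_le_sum fun j _ => h1 j).trans_eq ?_
    rw [Finset.sum_const, Finset.card_univ, Fintype.card_fin, nsmul_eq_mul]

end CellBlocks

/-! ### Asymptotics -/

section Asymptotics

theorem eventually_mul_rpow_le_rpow (C : ℝ) {t t' : ℝ} (h : t < t') :
    ∀ᶠ x : ℝ in atTop, C * x ^ t ≤ x ^ t' := by
  filter_upwards [(tendsto_rpow_atTop (sub_pos.2 h)).eventually_ge_atTop C, eventually_gt_atTop 0]
    with x hx hx0
  calc C * x ^ t ≤ x ^ (t' - t) * x ^ t := by gcongr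
    _ = x ^ t' := by rw [← Real.rpow_add hx0, sub_add_cancel]

theorem eventually_mul_rpow_mul_exp_le (C t : ℝ) {c δ : ℝ} (hc : 0 < c) (hδ : 0 < δ) :
    ∀ᶠ x : ℝ in atTop, C * x ^ t * Real.exp (-(c * x ^ δ)) ≤ x⁻¹ := by
  have h1 := (isLittleO_exp_neg_mul_rpow_atTop hc ((-1 - t - 1) / δ)).bound one_pos
  filter_upwards [(tendsto_rpow_atTop hδ).eventually h1, eventually_gt_atTop 0,
    eventually_ge_atTop C] with x hx hx0 hxC
  rw [Real.norm_of_nonneg (Real.exp_pos _).le, Real.norm_of_nonneg (by positivity),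
    one_mul, ← Real.rpow_mul hx0.le, mul_div_cancel₀ _ hδ.ne', neg_mul] at hx
  calc C * x ^ t * Real.exp (-(c * x ^ δ)) ≤ x * x ^ t * x ^ (-1 - t - 1) := by gcongr
    _ = x ^ (1 : ℝ) * x ^ t * x ^ (-1 - t - 1) := by rw [Real.rpow_one]
    _ = x ^ (-1 : ℝ) := by rw [← Real.rpow_add hx0, ← Real.rpow_add hx0]; congr 1; ring
    _ = x⁻¹ := Real.rpow_neg_one x

theorem half_le_floor {y : ℝ} (hy : 1 ≤ y) : y / 2 ≤ ⌊y⌋₊ := by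
  have h1 := Nat.lt_floor_add_one y
  have h2 : (1 : ℝ) ≤ ⌊y⌋₊ := by exact_mod_cast Nat.one_le_floor_iff y |>.2 hy
  linarith

/-- The scales `2 ^ (γ ^ k)`. -/
noncomputable def scale (γ : ℝ) (k : ℕ) : ℝ := 2 ^ (γ ^ k)

variable {γ : ℝ}

theorem scale_succ (γ : ℝ) (k : ℕ) : scale γ (k + 1) = scale γ k ^ γ := by
  rw [scale, scale, ← Real.rpow_mul (by norm_num), pow_succ]

theorem scale_mono (hγ : 1 < γ) : Monotone (scale γ) := fun _ _ h =>
  Real.rpow_le_rpow_of_exponent_le (by norm_num) (pow_le_pow_right₀ hγ.le h)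

theorem one_le_scale (hγ : 1 < γ) (k : ℕ) : 1 ≤ scale γ k :=
  Real.one_le_rpow (by norm_num) (pow_nonneg (by linarith) k)

theorem tendsto_scale (hγ : 1 < γ) : Tendsto (scale γ) atTop atTop :=
  (tendsto_rpow_atTop_of_base_gt_one 2 (by norm_num)).comp (tendsto_pow_atTop_atTop_of_one_lt hγ)

theorem summable_scale_rpow (hγ : 1 < γ) {δ : ℝ} (hδ : 0 < δ) :
    Summable fun k => scale γ k ^ (-δ) := by
  have hb : (2 : ℝ) ^ (-(δ * (γ - 1))) < 1 :=
    Real.rpow_lt_one_of_one_lt_of_neg (by norm_num) (by nlinarith [mul_pos hδ (sub_pos.2 hγ)])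
  refine Summable.of_nonneg_of_le (fun k => Real.rpow_nonneg ((one_le_scale hγ k).trans' zero_le_one) _)
    (fun k => ?_) (summable_geometric_of_lt_one (Real.rpow_nonneg (by norm_num) _) hb)
  rw [scale, ← Real.rpow_mul (by norm_num), ← Real.rpow_mul_natCast (by norm_num)]
  refine Real.rpow_le_rpow_of_exponent_le (by norm_num) ?_
  -- Bernoulli's inequality bounds `γ ^ k` below linearly, giving geometric decay.
  have h := one_add_mul_sub_le_pow (by linarith : -1 ≤ γ) k
  nlinarith

/-- The exponent inequality behind the Frostman condition. -/
theorem eventually_max_le {c C α' s a D₁ D₂ σ : ℝ} (hc : 0 < c) (hC : 0 < C) (hσ : 0 < σ)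
    (h3 : γ * α' * σ < a + s * D₁) (h4 : s * (D₂ - D₁) + α' * σ < a)
    (h5 : s * (D₂ - D₁) + α' * D₁ + γ * α' * (σ - D₁) < a) :
    ∀ᶠ x : ℝ in atTop, ∀ r, c * (2 * x ^ γ) ^ (-α') ≤ r → r < c * (2 * x) ^ (-α') →
      max 1 (C * (x ^ (-s)) ^ (-D₂) * (r / (2 * x) ^ (-α')) ^ D₁) ≤ r ^ σ * x ^ a * x ^ (s * D₁) := by
  set lo : ℝ := c * 2 ^ (-α') with hlo
  have hlo0 : 0 < lo := by positivity
  set A : ℝ := C * 2 ^ (α' * D₁) * lo ^ (D₁ - σ) with hA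
  have hA0 : 0 < A := by positivity
  filter_upwards [eventually_mul_rpow_le_rpow (lo ^ σ)⁻¹ h3, eventually_mul_rpow_le_rpow A h4,
    eventually_mul_rpow_le_rpow A h5, eventually_ge_atTop 1] with x hx3 hx4 hx5 hx1 r hr1 hr2
  have hx0 : 0 < x := by linarith
  have hr1' : lo * x ^ (-(γ * α')) ≤ r := by
    refine le_trans (le_of_eq ?_) hr1
    rw [hlo, Real.mul_rpow (by norm_num) (by positivity), ← Real.rpow_mul hx0.le]
    ring_nf
  have hr2' : r ≤ lo * x ^ (-α') := by
    refine hr2.le.trans (le_of_eq ?_)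
    rw [hlo, Real.mul_rpow (by norm_num) hx0.le]
    ring
  have hr0 : 0 < r := lt_of_lt_of_le (by positivity) hr1'
  refine max_le ?_ ?_
  · have h6 : lo ^ σ * x ^ (-(γ * α' * σ)) ≤ r ^ σ := by
      have := Real.rpow_le_rpow (by positivity) hr1' hσ.le
      rwa [Real.mul_rpow hlo0.le (by positivity), ← Real.rpow_mul hx0.le,
        show -(γ * α') * σ = -(γ * α' * σ) by ring] at this
    calc 1 = lo ^ σ * x ^ (-(γ * α' * σ)) * ((lo ^ σ)⁻¹ * x ^ (γ * α' * σ)) := by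
          rw [Real.rpow_neg hx0.le]
          field_simp
      _ ≤ r ^ σ * x ^ (a + s * D₁) := by gcongr
      _ = r ^ σ * x ^ a * x ^ (s * D₁) := by rw [Real.rpow_add hx0]; ring
  -- A monomial in `r` is largest at an endpoint: the upper one if `σ ≤ D₁` (hypothesis `h4`), the
  -- lower one otherwise (hypothesis `h5`).
  · have h6 : r ^ (D₁ - σ) * (C * 2 ^ (α' * D₁)) * x ^ (s * (D₂ - D₁) + α' * D₁) ≤ x ^ a := by
      rcases le_total σ D₁ with hD | hD
      · have h7 : r ^ (D₁ - σ) ≤ lo ^ (D₁ - σ) * x ^ (-(α' * (D₁ - σ))) := by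
          have := Real.rpow_le_rpow hr0.le hr2' (sub_nonneg.2 hD)
          rwa [Real.mul_rpow hlo0.le (by positivity), ← Real.rpow_mul hx0.le,
            show -α' * (D₁ - σ) = -(α' * (D₁ - σ)) by ring] at this
        refine le_trans ?_ hx4
        calc _ ≤ lo ^ (D₁ - σ) * x ^ (-(α' * (D₁ - σ))) * (C * 2 ^ (α' * D₁)) *
              x ^ (s * (D₂ - D₁) + α' * D₁) := by gcongr
          _ = A * (x ^ (-(α' * (D₁ - σ))) * x ^ (s * (D₂ - D₁) + α' * D₁)) := by rw [hA]; ring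
          _ = A * x ^ (s * (D₂ - D₁) + α' * σ) := by
              rw [← Real.rpow_add hx0]
              congr 2
              ring
      · have h7 : r ^ (D₁ - σ) ≤ lo ^ (D₁ - σ) * x ^ (γ * α' * (σ - D₁)) := by
          have := Real.rpow_le_rpow_of_nonpos (by positivity) hr1' (sub_nonpos.2 hD)
          rwa [Real.mul_rpow hlo0.le (by positivity), ← Real.rpow_mul hx0.le,
            show -(γ * α') * (D₁ - σ) = γ * α' * (σ - D₁) by ring] at this
        refine le_trans ?_ hx5
        calc _ ≤ lo ^ (D₁ - σ) * x ^ (γ * α' * (σ - D₁)) * (C * 2 ^ (α' * D₁)) *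
              x ^ (s * (D₂ - D₁) + α' * D₁) := by gcongr
          _ = A * (x ^ (s * (D₂ - D₁) + α' * D₁) * x ^ (γ * α' * (σ - D₁))) := by rw [hA]; ring
          _ = A * x ^ (s * (D₂ - D₁) + α' * D₁ + γ * α' * (σ - D₁)) := by
              rw [← Real.rpow_add hx0]
    have h8 : (r / (2 * x) ^ (-α')) ^ D₁ = r ^ D₁ * 2 ^ (α' * D₁) * x ^ (α' * D₁) := by
      rw [Real.rpow_neg (by positivity), div_inv_eq_mul, Real.mul_rpow hr0.le (by positivity),
        ← Real.rpow_mul (by positivity), Real.mul_rpow (by norm_num) hx0.le, mul_assoc]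
    have h9 : (x ^ (-s)) ^ (-D₂) = x ^ (s * (D₂ - D₁)) * x ^ (s * D₁) := by
      rw [← Real.rpow_mul hx0.le, ← Real.rpow_add hx0]
      congr 1
      ring
    rw [h8, h9]
    calc _ = r ^ σ * (r ^ (D₁ - σ) * (C * 2 ^ (α' * D₁)) * x ^ (s * (D₂ - D₁) + α' * D₁)) *
          x ^ (s * D₁) := by
          rw [show r ^ D₁ = r ^ σ * r ^ (D₁ - σ) by rw [← Real.rpow_add hr0]; congr 1; ring,
            Real.rpow_add hx0]
          ring
      _ ≤ r ^ σ * x ^ a * x ^ (s * D₁) := by gcongr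

end Asymptotics

/-! ### Consequences of Hypothesis `◇` for scaling factors, weights and good indices -/

section Hypotheses

variable {α β : ℝ} {lam w : ℕ → ℝ}

theorem HypDiamond.eventually_lam_le (h : HypDiamond α β lam w) :
    ∀ᶠ n : ℕ in atTop, lam n ≤ (n : ℝ) ^ (-(α / 2)) := by
  obtain ⟨o, ho, h1⟩ := h.lam_le
  have := h.alpha_pos
  filter_upwards [h1, ho.eventually (eventually_lt_nhds (half_pos h.alpha_pos)),
    eventually_ge_atTop 1] with n hn hon hn1
  exact hn.trans (Real.rpow_le_rpow_of_exponent_le (by exact_mod_cast hn1) (by linarith))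

/-- The weights are summable because `β > 1`; this keeps a fixed block attractive with probability
of the order of its weight. -/
theorem HypDiamond.exists_totalWeight_le (h : HypDiamond α β lam w) (hw : ∀ n ≥ 1, 0 ≤ w n) :
    ∃ W ≥ 1, ∀ n, totalWeight w n ≤ W := by
  obtain ⟨o, ho, h1⟩ := h.w_le
  have hβ := h.one_lt_beta
  set w' : ℕ → ℝ := fun n => if 1 ≤ n then w n else 0 with hw'
  have hw'0 : ∀ n, 0 ≤ w' n := fun n => by
    simp only [hw']
    split_ifs with hn
    exacts [hw n hn, le_rfl]
  have hsum : Summable w' := by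
    refine Summable.of_norm_bounded_eventually_nat
      (g := fun n : ℕ => (n : ℝ) ^ (-((1 + β) / 2))) (Real.summable_nat_rpow.2 (by linarith)) ?_
    filter_upwards [h1, ho.eventually (eventually_lt_nhds (show 0 < (β - 1) / 2 by linarith)),
      eventually_ge_atTop 1] with n hn hon hn1
    rw [Real.norm_of_nonneg (hw'0 n)]
    simp only [hw', if_pos hn1]
    exact hn.trans (Real.rpow_le_rpow_of_exponent_le (by exact_mod_cast hn1) (by linarith))
  refine ⟨max 1 (∑' n, w' n), le_max_left _ _, fun n => le_max_of_le_right ?_⟩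
  refine le_trans (le_of_eq ?_) (hsum.sum_le_tsum (Finset.Icc 1 n) fun i _ => hw'0 i)
  exact Finset.sum_congr rfl fun k hk => (if_pos (Finset.mem_Icc.1 hk).1).symm

theorem HypDiamond.eventually_le_card (h : HypDiamond α β lam w) {ε : ℝ} (hε : 0 < ε) :
    ∀ᶠ n : ℕ in atTop, (n : ℝ) ^ (1 - ε) ≤ (goodIndices α β lam w ε n).card := by
  obtain ⟨o, ho, h1⟩ := h.card_good ε hε
  filter_upwards [h1, ho.eventually (eventually_gt_nhds (show -ε < 0 by linarith)),
    eventually_ge_atTop 1] with n hn hon hn1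
  rw [hn]
  exact Real.rpow_le_rpow_of_exponent_le (by exact_mod_cast hn1) (by linarith)

end Hypotheses

theorem ae_eventually_notMem_of_eventually_le {Ω : Type*} [MeasurableSpace Ω] {P : Measure Ω}
    {s : ℕ → Set Ω} {f : ℕ → ℝ} (hf : Summable f)
    (h : ∀ᶠ k in atTop, P (s k) ≤ ENNReal.ofReal (f k)) :
    ∀ᵐ ω ∂P, ∀ᶠ k in atTop, ω ∉ s k := by
  obtain ⟨k₁, hk₁⟩ := eventually_atTop.1 h
  have h1 : ∑' k, P (s (k + k₁)) ≠ ∞ := by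
    refine ne_top_of_le_ne_top ?_ (ENNReal.tsum_le_tsum fun k => hk₁ (k + k₁) (by omega))
    exact ((summable_nat_add_iff k₁).2 hf).tsum_ofReal_ne_top
  filter_upwards [ae_eventually_notMem h1] with ω hω
  obtain ⟨k₂, hk₂⟩ := eventually_atTop.1 hω
  filter_upwards [eventually_ge_atTop (k₂ + k₁)] with k hk
  have h2 := hk₂ (k - k₁) (by omega)
  rwa [Nat.sub_add_cancel (by omega)] at h2

/-! ### The random tree along the scales and its Frostman exponent -/

section Core

variable {U : Type*} [MetricSpace U] [SecondCountableTopology U] [MeasurableSpace U] [BorelSpace U]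
  {u₀ : U} {Ω : Type*} [MeasurableSpace Ω] {P : Measure Ω} [IsProbabilityMeasure P]
  {α β d : ℝ} {lam w : ℕ → ℝ} {τ : Measure (Block U u₀)}
  {B : ℕ → Ω → Block U u₀} {K : ℕ → Ω → ℕ} {X : ℕ → Ω → U}

theorem mem_goodIndices {ε : ℝ} {n k : ℕ} (h : k ∈ goodIndices α β lam w ε n) :
    (n ≤ k ∧ k ≤ 2 * n) ∧ (n : ℝ) ^ (-β - ε) ≤ w k ∧ (n : ℝ) ^ (-α - ε) ≤ lam k := by
  classical
  have h' := Finset.mem_filter.1 h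
  exact ⟨Finset.mem_Icc.1 h'.1, h'.2⟩

theorem card_goodIndices_le (ε : ℝ) (n : ℕ) : (goodIndices α β lam w ε n).card ≤ n + 1 := by
  classical
  refine (Finset.card_filter_le _ _).trans ?_
  rw [Nat.card_Icc]
  omega

theorem ceil_le_two_mul {x : ℝ} (hx : 1 ≤ x) : (⌈x⌉₊ : ℝ) ≤ 2 * x := by
  have := Nat.ceil_lt_add_one (by linarith : 0 ≤ x)
  linarith

/-- Here `s` fixes the cell radius, `θ` the number of groups and `a` the growth of the number of
paths. `h1` makes failures stretched-exponentially rare, `h2` says that branching sustains the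
growth `a`, and `h3`, `h4`, `h5` are the Frostman inequalities. -/
theorem IsGluingProcess.ae_ofReal_le_dimH_of_exponents (hglue : IsGluingProcess P τ w B K X)
    (hd : 0 ≤ d) (hlam : ∀ n, 0 < lam n) (hw : ∀ n ≥ 1, 0 ≤ w n) (hw₁ : 0 < w 1)
    (hdiamond : HypDiamond α β lam w) (hτ : HypH d τ)
    {γ s θ a σ ε D₁ : ℝ} (hγ : 1 < γ) (hs : 0 < s) (hθ : 0 ≤ θ) (hσ : 0 < σ) (hε : 0 < ε)
    (hD : d = 0 ∧ D₁ = 0 ∨ ε < d ∧ D₁ = d - ε)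
    (h1 : β + ε + θ + s * (d + ε) < γ * (1 - ε)) (h2 : a * (γ - 1) < s * D₁ + θ)
    (h3 : γ * (α + ε) * σ < a + s * D₁) (h4 : s * (d + ε - D₁) + (α + ε) * σ < a)
    (h5 : s * (d + ε - D₁) + (α + ε) * D₁ + γ * (α + ε) * (σ - D₁) < a) :
    ∀ᵐ ω ∂P, ENNReal.ofReal σ ≤
      dimH (leaves hlam (fun n => B n ω) (fun n => K n ω) (fun n => X n ω)) := by
  have hτprob := hglue.isProbabilityMeasure
  have hα := hdiamond.alpha_pos
  have hβ := hdiamond.one_lt_beta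
  have hD₁ : 0 ≤ D₁ := by rcases hD with ⟨-, rfl⟩ | ⟨h, rfl⟩ <;> linarith
  have hε1 : 0 < 1 - ε := by
    have : 0 < γ * (1 - ε) := lt_of_le_of_lt (by positivity) h1
    exact pos_of_mul_pos_right this (by linarith)
  obtain ⟨p, c, M, C, R₀, hp, hc, hM, hC, hR₀, hcells⟩ := hτ.exists_cells hd hε hD
  obtain ⟨W, hW1, hW⟩ := hdiamond.exists_totalWeight_le hw
  have hW0 : 0 < W := by linarith
  set x : ℕ → ℝ := scale γ with hx
  have hx1 : ∀ k, 1 ≤ x k := one_le_scale hγ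
  have hx0 : ∀ k, 0 < x k := fun k => zero_lt_one.trans_le (hx1 k)
  have hxs : ∀ k, x (k + 1) = x k ^ γ := scale_succ γ
  have hxt : Tendsto x atTop atTop := tendsto_scale hγ
  set N : ℕ → ℕ := fun k => ⌈x k⌉₊ with hN
  have hNx : ∀ k, x k ≤ N k := fun k => Nat.le_ceil _
  have hN2 : ∀ k, (N k : ℝ) ≤ 2 * x k := fun k => ceil_le_two_mul (hx1 k)
  have hN1 : ∀ k, 1 ≤ N k := fun k => by exact_mod_cast (hx1 k).trans (hNx k)
  have hNt : Tendsto N atTop atTop := tendsto_nat_ceil_atTop.comp hxt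
  set G : ℕ → Finset ℕ := fun k => goodIndices α β lam w ε (N k) with hG
  have hG1 : ∀ k, ∀ i ∈ G k, 1 ≤ i := fun k i hi => (hN1 k).trans (mem_goodIndices hi).1.1
  set R : ℕ → ℝ := fun k => x k ^ (-s) with hR
  have hR0 : ∀ k, 0 < R k := fun k => Real.rpow_pos_of_pos (hx0 k) _
  have hRle : ∀ k, R k ≤ 1 := fun k => Real.rpow_le_one_of_one_le_of_nonpos (hx1 k) (by linarith)
  have hRpow : ∀ k, R k ^ (-D₁) = x k ^ (s * D₁) := fun k => by
    rw [hR, ← Real.rpow_mul (hx0 k).le]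
    congr 1
    ring
  set m : ℕ → ℕ := fun k => ⌊R k ^ (-D₁)⌋₊ with hm
  set q : ℕ → ℕ := fun k => ⌊x k ^ θ⌋₊ with hq
  set h : ℕ → ℕ := fun k => ⌊x k ^ (γ * (1 - ε) - θ)⌋₊ with hh
  set v : ℕ → ℝ := fun k => R k ^ (d + ε) with hv
  have hv0 : ∀ k, 0 < v k := fun k => Real.rpow_pos_of_pos (hR0 k) _
  have hv1 : ∀ k, v k ≤ 1 := fun k => Real.rpow_le_one (hR0 k).le (hRle k) (by linarith)
  -- Lower bound for the probability that a given later block is grafted in a given cell of a good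
  -- block of level `k`.
  set u : ℕ → ℝ := fun k => (2 * x k) ^ (-β - ε) / W * v k with hu
  have hm1 : ∀ k, 1 ≤ R k ^ (-D₁) := fun k => by
    rw [hRpow]
    exact Real.one_le_rpow (hx1 k) (by positivity)
  have hq1 : ∀ k, 1 ≤ x k ^ θ := fun k => Real.one_le_rpow (hx1 k) hθ
  have hθ' : 0 < γ * (1 - ε) - θ := by
    have : 0 ≤ s * (d + ε) := by positivity
    linarith
  have hh1 : ∀ k, 1 ≤ x k ^ (γ * (1 - ε) - θ) := fun k => Real.one_le_rpow (hx1 k) hθ'.le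
  have e1 : ∀ᶠ k in atTop, R k ∈ Set.Ioo 0 R₀ := by
    have : Tendsto R atTop (𝓝 0) := (tendsto_rpow_neg_atTop hs).comp hxt
    filter_upwards [this.eventually (eventually_lt_nhds hR₀)] with k hk using ⟨hR0 k, hk⟩
  have e2 : ∀ᶠ k in atTop, ∀ i ∈ G k, lam i ≤ x k ^ (-(α / 2)) := by
    obtain ⟨n₀, hn₀⟩ := eventually_atTop.1 hdiamond.eventually_lam_le
    filter_upwards [hNt.eventually_ge_atTop n₀] with k hk i hi
    have h6 := (mem_goodIndices hi).1.1
    refine (hn₀ i (hk.trans h6)).trans ?_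
    exact Real.rpow_le_rpow_of_nonpos (hx0 k) ((hNx k).trans (Nat.cast_le.2 h6)) (by linarith)
  have hcardG : ∀ᶠ k in atTop, x k ^ (1 - ε) ≤ (G k).card := by
    filter_upwards [hNt.eventually (hdiamond.eventually_le_card hε)] with k hk
    exact (Real.rpow_le_rpow (hx0 k).le (hNx k) hε1.le).trans hk
  have e3 : ∀ᶠ k in atTop, q k * h k ≤ (G (k + 1)).card := by
    filter_upwards [(tendsto_add_atTop_nat 1).eventually hcardG] with k hk
    have h6 : (q k : ℝ) ≤ x k ^ θ := Nat.floor_le (by linarith [hq1 k])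
    have h7 : (h k : ℝ) ≤ x k ^ (γ * (1 - ε) - θ) := Nat.floor_le (by linarith [hh1 k])
    have h8 : (q k : ℝ) * h k ≤ (G (k + 1)).card := by
      calc (q k : ℝ) * h k ≤ x k ^ θ * x k ^ (γ * (1 - ε) - θ) := by
            have := hx0 k
            gcongr
        _ = x (k + 1) ^ (1 - ε) := by
            rw [hxs, ← Real.rpow_mul (hx0 k).le, ← Real.rpow_add (hx0 k)]
            congr 1
            ring
        _ ≤ _ := hk
    exact_mod_cast h8
  have e4 : ∀ᶠ k in atTop, 2 * N k < N (k + 1) := by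
    filter_upwards [hxt.eventually (eventually_mul_rpow_le_rpow 5 hγ)] with k hk
    rw [Real.rpow_one, ← hxs] at hk
    have h6 := hN2 k
    have h7 := hNx (k + 1)
    have h8 := hx0 k
    have : (2 * N k : ℝ) < N (k + 1) := by linarith
    exact_mod_cast this
  set δ : ℝ := γ * (1 - ε) - θ - s * (d + ε) - β - ε with hδ
  have hδ0 : 0 < δ := by linarith
  set κ : ℝ := p * (2 ^ (-β - ε) / W / 2) with hκ
  have hκ0 : 0 < κ := by positivity
  have e5 : ∀ᶠ k in atTop, Real.exp (-(p * (G k).card)) +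
      (G k).card * (q k * (m k * Real.exp (-(p * u k * h k)))) ≤ 2 * x k ^ (-(1 : ℝ)) := by
    filter_upwards [hcardG, hxt.eventually (eventually_mul_rpow_mul_exp_le 1 0 hp hε1),
      hxt.eventually (eventually_mul_rpow_mul_exp_le 3 (1 + θ + s * D₁) hκ0 hδ0)] with k hk hka hkb
    have hxk := hx0 k
    have h6 : Real.exp (-(p * (G k).card)) ≤ (x k)⁻¹ := by
      refine le_trans ?_ hka
      rw [Real.rpow_zero, mul_one, one_mul]
      refine Real.exp_le_exp.2 (neg_le_neg ?_)
      gcongr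
    have h7 : ((G k).card : ℝ) ≤ 3 * x k := by
      have := card_goodIndices_le (α := α) (β := β) (lam := lam) (w := w) ε (N k)
      have h8 : ((G k).card : ℝ) ≤ N k + 1 := by exact_mod_cast this
      linarith [hN2 k, hx1 k]
    have h8 : (q k : ℝ) ≤ x k ^ θ := Nat.floor_le (by linarith [hq1 k])
    have h9 : (m k : ℝ) ≤ x k ^ (s * D₁) := by
      rw [← hRpow]
      exact Nat.floor_le (by linarith [hm1 k])
    have h10 : κ * x k ^ δ ≤ p * u k * h k := by
      have h11 : x k ^ (γ * (1 - ε) - θ) / 2 ≤ h k := half_le_floor (hh1 k)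
      have h12 : v k = x k ^ (-(s * (d + ε))) := by
        simp only [hv, hR]
        rw [← Real.rpow_mul hxk.le]
        congr 1
        ring
      have h13 : x k ^ δ = x k ^ (-β - ε) * x k ^ (-(s * (d + ε))) * x k ^ (γ * (1 - ε) - θ) := by
        rw [← Real.rpow_add hxk, ← Real.rpow_add hxk]
        congr 1
        rw [hδ]
        ring
      calc κ * x k ^ δ = p * u k * (x k ^ (γ * (1 - ε) - θ) / 2) := by
            rw [h13, hκ, hu]
            simp only
            rw [h12, Real.mul_rpow (by norm_num) hxk.le]
            ring
        _ ≤ p * u k * h k := by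
            have : 0 ≤ u k := by have := hv0 k; positivity
            gcongr
    have h14 : ((G k).card : ℝ) * (q k * (m k * Real.exp (-(p * u k * h k)))) ≤ (x k)⁻¹ := by
      refine le_trans ?_ hkb
      calc _ ≤ 3 * x k * (x k ^ θ * (x k ^ (s * D₁) * Real.exp (-(κ * x k ^ δ)))) := by
            gcongr
        _ = _ := by
            rw [Real.rpow_add hxk, Real.rpow_add hxk, Real.rpow_one]
            ring
    rw [Real.rpow_neg_one]
    linarith
  have e6 : ∀ᶠ k in atTop, x k ^ (a * (γ - 1)) ≤ (q k * m k : ℕ) := by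
    -- The `4` pays for the two integer parts in `q k` and `m k`.
    filter_upwards [hxt.eventually (eventually_mul_rpow_le_rpow 4 h2)] with k hk
    have hxk := hx0 k
    have h6 : x k ^ θ / 2 ≤ q k := half_le_floor (hq1 k)
    have h7 : x k ^ (s * D₁) / 2 ≤ m k := by
      rw [← hRpow]
      exact half_le_floor (hm1 k)
    rw [Real.rpow_add hxk] at hk
    rw [Nat.cast_mul]
    calc x k ^ (a * (γ - 1)) ≤ x k ^ θ / 2 * (x k ^ (s * D₁) / 2) := by linarith
      _ ≤ q k * m k := by gcongr
  have e7 := hxt.eventually (eventually_max_le (γ := γ) (D₂ := d + ε) hc hC hσ h3 h4 h5)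
  -- The first levels, where the asymptotic conditions may fail, get dummy families here and below;
  -- the tree starts beyond them, at level `k₀`.
  have hex1 : ∀ k, ∃ S : ℕ → Fin (m k) → Set U, R k ∈ Set.Ioo 0 R₀ →
      (∀ t, IsCellFamily u₀ c M C D₁ (d + ε) (R k) (S t)) ∧
        ENNReal.ofReal p ≤ τ (cellBlocks u₀ (v k) S) := fun k => by
    by_cases hk : R k ∈ Set.Ioo 0 R₀
    · obtain ⟨S, hS⟩ := hcells (R k) hk
      exact ⟨S, fun _ => hS⟩
    · exact ⟨fun _ _ => ∅, fun h => absurd h hk⟩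
  choose S hS using hex1
  have hex2 : ∀ k, ∃ g : Fin (q k) → Finset ℕ, q k * h k ≤ (G (k + 1)).card →
      (∀ l, ∀ n ∈ g l, n + 1 ∈ G (k + 1)) ∧ (∀ l, (g l).card = h k) ∧
        Pairwise fun l l' => Disjoint (g l) (g l') := fun k => by
    by_cases hk : q k * h k ≤ (G (k + 1)).card
    · have hinj : Set.InjOn (fun i => i - 1) (G (k + 1) : Set ℕ) := fun i hi j hj hij => by
        have := hG1 (k + 1) i hi
        have := hG1 (k + 1) j hj
        simp only at hij
        omega
      obtain ⟨g, hg1, hg2, hg3⟩ := exists_disjoint_subfamilies ((G (k + 1)).image fun i => i - 1)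
        (q k) (h k) (by rwa [Finset.card_image_of_injOn hinj])
      refine ⟨g, fun _ => ⟨fun l n hn => ?_, hg2, hg3⟩⟩
      obtain ⟨i, hi, rfl⟩ := Finset.mem_image.1 (hg1 l hn)
      rwa [Nat.sub_add_cancel (hG1 (k + 1) i hi)]
    · exact ⟨fun _ => ∅, fun h => absurd h hk⟩
  choose g hg using hex2
  have hbad : ∀ᵐ ω ∂P, ∀ᶠ k in atTop, ω ∉ badLevel B K X (G k) (v k) (S k) (g k)
      (cellBlocks u₀ (v (k + 1)) (S (k + 1))) := by
    refine ae_eventually_notMem_of_eventually_le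
      ((summable_scale_rpow hγ one_pos).mul_left 2) ?_
    filter_upwards [e1, (tendsto_add_atTop_nat 1).eventually e1, e3, e4, e5] with k he1 he1' he3 he4 he5
    obtain ⟨hg1, hg2, -⟩ := hg k he3
    refine le_trans (hglue.measure_badLevel_le hw hw₁ (hG1 k)
      (fun t j => ((hS k he1).1 t).measurableSet j) (h := h k) (p := p) (u := u k) ?_ hg2
      (measurableSet_cellBlocks _ fun t j => ((hS (k + 1) he1').1 t).measurableSet j)
      (hS k he1).2 (hS (k + 1) he1').2 ?_ ?_ ?_) (ENNReal.ofReal_le_ofReal he5)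
    -- The shift costs nothing: `i ≤ 2 * N k < N (k + 1) ≤ n + 1`.
    · intro l n hn i hi
      have h6 := (mem_goodIndices (hg1 l n hn)).1.1
      have h7 := (mem_goodIndices hi).1.2
      omega
    · have := hx0 k
      have := hv0 k
      positivity
    · have h6 : (2 * x k) ^ (-β - ε) ≤ 1 :=
        Real.rpow_le_one_of_one_le_of_nonpos (by linarith [hx1 k]) (by linarith)
      exact mul_le_one₀ ((div_le_one hW0).2 (h6.trans hW1)) (hv0 k).le (hv1 k)
    · intro i hi l n hn
      have h6 := (mem_goodIndices hi).2.1
      have h7 : (2 * x k) ^ (-β - ε) ≤ (N k : ℝ) ^ (-β - ε) :=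
        Real.rpow_le_rpow_of_nonpos (by exact_mod_cast hN1 k) (hN2 k) (by linarith)
      have h8 := (mem_goodIndices (hg1 l n hn)).1.1
      have h9 := totalWeight_pos hw hw₁ (n := n) (by have := hN1 k; omega)
      refine mul_le_mul_of_nonneg_right ?_ (hv0 k).le
      exact div_le_div₀ (hw i (hG1 k i hi)) (h7.trans h6) h9 (hW n)
  obtain ⟨k₁, hk₁⟩ := eventually_atTop.1
    (e1.and (e2.and (e3.and (e4.and (e6.and e7)))))
  filter_upwards [hbad] with ω hω
  obtain ⟨k₂, hk₂⟩ := eventually_atTop.1 hω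
  set k₀ := max k₁ k₂ with hk₀
  have hk₁' : ∀ k, k₁ ≤ k₀ + k := fun k => (le_max_left k₁ k₂).trans (Nat.le_add_right _ _)
  have hk₂' : ∀ k, k₂ ≤ k₀ + k := fun k => (le_max_right k₁ k₂).trans (Nat.le_add_right _ _)
  have hnb : ∀ k, ω ∉ badLevel B K X (G (k₀ + k)) (v (k₀ + k)) (S (k₀ + k)) (g (k₀ + k))
      (cellBlocks u₀ (v (k₀ + k + 1)) (S (k₀ + k + 1))) := fun k => hk₂ _ (hk₂' k)
  set l : ℕ → ℝ := fun k => (2 * x (k₀ + k)) ^ (-(α + ε)) with hl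
  set b : ℕ → ℝ := fun k => x (k₀ + k) ^ (-(α / 2)) * M with hb
  obtain ⟨T, hT⟩ := exists_blockTree (fun n => B n ω) (K := fun n => K n ω) (X := fun n => X n ω)
    (lam := lam) (c := c) (M := M) (C := C) (D₁ := D₁) (D₂ := d + ε) (l := l) (b := b)
    (R := fun k => R (k₀ + k)) (v := fun k => v (k₀ + k)) (G := fun k => G (k₀ + k))
    (m := fun k => m (k₀ + k)) (q := fun k => q (k₀ + k))
    (fun k => Nat.floor_pos.2 (hm1 _)) (fun k => Nat.floor_pos.2 (hq1 _))
    (S := fun k => S (k₀ + k)) (fun k t => (hS _ (hk₁ _ (hk₁' k)).1).1 t)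
    (g := fun k => g (k₀ + k)) (fun k => (hg _ (hk₁ _ (hk₁' k)).2.2.1).1)
    (fun k => (hg _ (hk₁ _ (hk₁' k)).2.2.1).2.2)
    (fun k => hG1 _)
    (fun k i hi j hj => by
      have h6 := (mem_goodIndices hi).1.2
      have h7 := (mem_goodIndices hj).1.1
      have h8 := (hk₁ _ (hk₁' k)).2.2.2.1
      rw [← add_assoc] at h7
      omega)
    (fun k i hi => le_trans (by
      simp only [hl]
      rw [neg_add']
      exact Real.rpow_le_rpow_of_nonpos (by exact_mod_cast hN1 _) (hN2 _) (by linarith))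
      (mem_goodIndices hi).2.2)
    (fun k i _ => (hlam i).le)
    (fun k i hi => mul_le_mul_of_nonneg_right ((hk₁ _ (hk₁' k)).2.1 i hi) hM.le)
    (by
      have h6 := hnb 0
      simp only [badLevel, Set.mem_union, not_or] at h6
      have h7 := h6.1
      simp only [Set.mem_ofPred_eq, not_forall, not_not] at h7
      obtain ⟨i, hi, hiB⟩ := h7
      exact ⟨i, hi, hiB⟩)
    (fun k i hi hiB j => by
      have h6 := hnb k
      simp only [badLevel, Set.mem_union, not_or] at h6
      by_contra! h7
      refine h6.2 (Set.mem_iUnion₂.2 ⟨i, hi, Set.mem_iUnion.2 ⟨j, hiB, fun t => ?_⟩⟩)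
      obtain ⟨a, ha⟩ := h7 t
      exact ⟨a, fun n hn h8 => ha n hn h8.1 h8.2.1 h8.2.2⟩)
  have hxm : Monotone x := scale_mono hγ
  have hx00 := hx0 k₀
  -- Telescoping: passing to the next scale multiplies `x ^ a` by `x ^ (a * (γ - 1))`, at most the
  -- number of children.
  have hprod : ∀ k, x (k₀ + k) ^ a ≤ x k₀ ^ a * ∏ j ∈ Finset.range k, (T.size j : ℝ) := by
    intro k
    induction k with
    | zero => simp
    | succ k ih =>
      have hxk := hx0 (k₀ + k)
      have h6 := (hk₁ _ (hk₁' k)).2.2.2.2.1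
      rw [← hT k] at h6
      rw [Finset.prod_range_succ, ← mul_assoc, ← add_assoc, hxs, ← Real.rpow_mul hxk.le,
        show γ * a = a + a * (γ - 1) by ring, Real.rpow_add hxk]
      exact mul_le_mul ih h6 (by positivity) (by positivity)
  -- The `2` comes from the integer part in `m`, the other factor from starting at level `k₀`.
  refine T.ofReal_le_dimH_leaves hlam (fun n => B n ω) ?_ hσ (C := 2 * x k₀ ^ a) (by positivity)
    hc ?_ ?_ ?_ ?_
  · have h6 := (summable_nat_add_iff k₀).2 (summable_scale_rpow hγ (half_pos hα))
    have h7 : b = fun k => scale γ (k + k₀) ^ (-(α / 2)) * M := by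
      ext k
      simp only [hb, hx, add_comm k₀]
    rw [h7]
    exact h6.mul_right M
  · intro k k' hkk
    exact Real.rpow_le_rpow_of_nonpos (by have := hx0 (k₀ + k); positivity)
      (by have := hxm (show k₀ + k ≤ k₀ + k' by omega); linarith) (by linarith)
  · intro k
    have := hx0 (k₀ + k)
    positivity
  · have h6 : Tendsto (fun k => 2 * x (k₀ + k)) atTop atTop := by
      refine Tendsto.const_mul_atTop two_pos (hxt.comp ?_)
      exact tendsto_atTop_mono (fun k => Nat.le_add_left k k₀) tendsto_id
    exact (tendsto_rpow_neg_atTop (by linarith : 0 < α + ε)).comp h6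
  · intro k r hr1 hr2
    have hxk := hx0 (k₀ + k)
    have hr0 : 0 < r := lt_of_lt_of_le
      (by have := hx0 (k₀ + (k + 1)); positivity) hr1
    have h6 := (hk₁ _ (hk₁' k)).2.2.2.2.2 r (by rw [← hxs]; exact hr1) hr2
    have h7 : x (k₀ + k) ^ (s * D₁) / 2 ≤ m (k₀ + k) := by
      rw [← hRpow]
      exact half_le_floor (hm1 _)
    rw [Finset.prod_range_succ, hT k, Nat.cast_mul]
    have hP : 0 ≤ ∏ j ∈ Finset.range k, (T.size j : ℝ) :=
      Finset.prod_nonneg fun j _ => Nat.cast_nonneg _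
    calc (q (k₀ + k) : ℝ) * max 1 (C * R (k₀ + k) ^ (-(d + ε)) * (r / l k) ^ D₁)
        ≤ q (k₀ + k) * (r ^ σ * x (k₀ + k) ^ a * x (k₀ + k) ^ (s * D₁)) := by gcongr
      _ ≤ q (k₀ + k) * (r ^ σ * (x k₀ ^ a * ∏ j ∈ Finset.range k, (T.size j : ℝ)) *
            (2 * m (k₀ + k))) := by
          gcongr
          · exact hprod k
          · linarith
      _ = _ := by ring

end Core

/-! ### Choice of the exponents -/

section Exponents

variable {U : Type*} [MetricSpace U] [SecondCountableTopology U] [MeasurableSpace U] [BorelSpace U]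
  {u₀ : U} {Ω : Type*} [MeasurableSpace Ω] {P : Measure Ω} [IsProbabilityMeasure P]
  {α β d : ℝ} {lam w : ℕ → ℝ} {τ : Measure (Block U u₀)}
  {B : ℕ → Ω → Block U u₀} {K : ℕ → Ω → ℕ} {X : ℕ → Ω → U}

/-- Each inequality is strict at `ε = 0` and continuous in `ε`, so it persists for small `ε`. For `d
= 0` the exponent `D₁` stays at `0`. -/
theorem exists_perturbed_exponents (hd : 0 ≤ d) {γ s θ a σ : ℝ}
    (h1 : β + θ + s * d < γ) (h2 : a * (γ - 1) < s * d + θ) (h3 : γ * α * σ < a + s * d)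
    (h4 : α * σ < a) (h5 : α * d + γ * α * (σ - d) < a) :
    ∃ ε D₁ : ℝ, 0 < ε ∧ (d = 0 ∧ D₁ = 0 ∨ ε < d ∧ D₁ = d - ε) ∧
      β + ε + θ + s * (d + ε) < γ * (1 - ε) ∧ a * (γ - 1) < s * D₁ + θ ∧
      γ * (α + ε) * σ < a + s * D₁ ∧ s * (d + ε - D₁) + (α + ε) * σ < a ∧
      s * (d + ε - D₁) + (α + ε) * D₁ + γ * (α + ε) * (σ - D₁) < a := by
  obtain ⟨D, hD, hD0, hDε⟩ : ∃ D : ℝ → ℝ, Continuous D ∧ D 0 = d ∧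
      ∀ᶠ ε in 𝓝[>] (0 : ℝ), d = 0 ∧ D ε = 0 ∨ ε < d ∧ D ε = d - ε := by
    rcases hd.eq_or_lt with rfl | hd
    · exact ⟨fun _ => 0, continuous_const, rfl, Eventually.of_forall fun _ => Or.inl ⟨rfl, rfl⟩⟩
    · refine ⟨fun ε => d - ε, continuous_const.sub continuous_id, sub_zero d, ?_⟩
      filter_upwards [Ioo_mem_nhdsGT hd] with ε hε using Or.inr ⟨hε.2, rfl⟩
  have key : ∀ f g : ℝ → ℝ, Continuous f → Continuous g → f 0 < g 0 →
      ∀ᶠ ε in 𝓝[>] (0 : ℝ), f ε < g ε := fun f g hf hg h =>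
    (hf.continuousAt.eventually_lt hg.continuousAt h).filter_mono nhdsWithin_le_nhds
  have k1 := key (fun ε => β + ε + θ + s * (d + ε)) (fun ε => γ * (1 - ε)) (by fun_prop)
    (by fun_prop) (by simpa using h1)
  have k2 := key (fun _ => a * (γ - 1)) (fun ε => s * D ε + θ) (by fun_prop) (by fun_prop)
    (by simpa [hD0] using h2)
  have k3 := key (fun ε => γ * (α + ε) * σ) (fun ε => a + s * D ε) (by fun_prop) (by fun_prop)
    (by simpa [hD0] using h3)
  have k4 := key (fun ε => s * (d + ε - D ε) + (α + ε) * σ) (fun _ => a) (by fun_prop)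
    (by fun_prop) (by simpa [hD0] using h4)
  have k5 := key (fun ε => s * (d + ε - D ε) + (α + ε) * D ε + γ * (α + ε) * (σ - D ε))
    (fun _ => a) (by fun_prop) (by fun_prop) (by simpa [hD0] using h5)
  obtain ⟨ε, hε, ⟨h0, e1, e2⟩, e3, e4, e5⟩ := (eventually_mem_nhdsWithin.and
    ((hDε.and (k1.and k2)).and (k3.and (k4.and k5)))).exists
  exact ⟨ε, D ε, hε, h0, e1, e2, e3, e4, e5⟩

theorem IsGluingProcess.ae_ofReal_le_dimH (hglue : IsGluingProcess P τ w B K X)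
    (hd : 0 ≤ d) (hlam : ∀ n, 0 < lam n) (hw : ∀ n ≥ 1, 0 ≤ w n) (hw₁ : 0 < w 1)
    (hdiamond : HypDiamond α β lam w) (hτ : HypH d τ)
    {γ s θ a σ : ℝ} (hγ : 1 < γ) (hs : 0 < s) (hθ : 0 ≤ θ) (hσ : 0 < σ)
    (h1 : β + θ + s * d < γ) (h2 : a * (γ - 1) < s * d + θ) (h3 : γ * α * σ < a + s * d)
    (h4 : α * σ < a) (h5 : α * d + γ * α * (σ - d) < a) :
    ∀ᵐ ω ∂P, ENNReal.ofReal σ ≤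
      dimH (leaves hlam (fun n => B n ω) (fun n => K n ω) (fun n => X n ω)) := by
  obtain ⟨ε, D₁, hε, hD, e1, e2, e3, e4, e5⟩ := exists_perturbed_exponents hd h1 h2 h3 h4 h5
  exact hglue.ae_ofReal_le_dimH_of_exponents hd hlam hw hw₁ hdiamond hτ hγ hs hθ hσ hε hD
    e1 e2 e3 e4 e5

/-- With `s = α * (γ - 1)` the rescaled cells have the size of the blocks of the next level. Put `c
= α * d`. At the limit of the constraints `θ = γ * (1 - c) - β + c`, and the bound on `α * σ` is `c
+ θ / (γ * (γ - 1))`; the chosen `γ` is its critical point, where `θ = y`. -/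
theorem exists_exponents_of_lt_one {σ : ℝ} (hα : 0 < α) (hβ : 1 < β) (hd : 0 ≤ d)
    (hαd : α * d < 1) (hσ : σ < (2 * β - 1 - 2 * √((β - 1) * (β - α * d))) / α) :
    ∃ γ s θ a : ℝ, 1 < γ ∧ 0 < s ∧ 0 ≤ θ ∧ β + θ + s * d < γ ∧ a * (γ - 1) < s * d + θ ∧
      γ * α * σ < a + s * d ∧ α * σ < a ∧ α * d + γ * α * (σ - d) < a := by
  set c := α * d with hc
  have hc0 : 0 ≤ c := by positivity
  set y := √((β - 1) * (β - c)) with hy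
  have hpos : 0 < (β - 1) * (β - c) := mul_pos (by linarith) (by linarith)
  have hy0 : 0 < y := Real.sqrt_pos.2 hpos
  have hy2 : y ^ 2 = (β - 1) * (β - c) := Real.sq_sqrt hpos.le
  have hc1 : 0 < 1 - c := by linarith
  set γ := (β - c + y) / (1 - c) with hγdef
  have hγc : γ * (1 - c) = β - c + y := div_mul_cancel₀ _ hc1.ne'
  have hγ_sub : (γ - 1) * (1 - c) = β - 1 + y := by linarith
  have hγ : 0 < γ - 1 := pos_of_mul_pos_left (by rw [hγ_sub]; linarith) hc1.le
  have hγ0 : 0 < γ := by linarith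
  have hσ' : α * σ < 2 * β - 1 - 2 * y := by
    rw [lt_div_iff₀ hα] at hσ
    linarith
  have hid : γ * (γ - 1) * (2 * β - 1 - 2 * y - c) = y := by
    have h1 : γ * (γ - 1) * (2 * β - 1 - 2 * y - c) * (1 - c) ^ 2 = y * (1 - c) ^ 2 := by
      calc _ = (γ * (1 - c)) * ((γ - 1) * (1 - c)) * (2 * β - 1 - 2 * y - c) := by ring
        _ = (β - c + y) * (β - 1 + y) * (2 * β - 1 - 2 * y - c) := by rw [hγc, hγ_sub]
        _ = _ := by
          linear_combination -(2 * β - 1 - c + 2 * y) * hy2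
    exact mul_right_cancel₀ (pow_pos hc1 2).ne' h1
  -- The gap between `t` and `y` is the room for strict inequalities: `θ` gives up `δ`, `a` uses `y
  -- - 2 * δ`. The maximum with `0` keeps `a ≥ c`.
  set t := max 0 (γ * (γ - 1) * (α * σ - c)) with ht
  have ht0 : 0 ≤ t := le_max_left _ _
  have htσ : γ * (γ - 1) * (α * σ - c) ≤ t := le_max_right _ _
  have hty : t < y := by
    refine max_lt hy0 ?_
    rw [← hid]
    exact mul_lt_mul_of_pos_left (by linarith) (by positivity)
  set δ := (y - t) / 4 with hδ
  have hsd : α * (γ - 1) * d = c * (γ - 1) := by rw [hc]; ring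
  set a := c + (y - 2 * δ) / (γ - 1) with ha
  have haγ : a * (γ - 1) = c * (γ - 1) + (y - 2 * δ) := by
    rw [ha, add_mul, div_mul_cancel₀ _ hγ.ne']
  have h3 : γ * (α * σ) < a + c * (γ - 1) := by
    have h6 : γ * (γ - 1) * (α * σ - c) < y - 2 * δ := by linarith
    have h7 : γ * (α * σ - c) < (y - 2 * δ) / (γ - 1) := by
      rw [lt_div_iff₀ hγ]
      linarith
    rw [ha]
    linarith
  refine ⟨γ, α * (γ - 1), y - δ, a, by linarith, by positivity, by linarith, ?_, ?_, ?_, ?_, ?_⟩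
  · rw [hsd]
    linarith
  · rw [hsd, haγ]
    linarith
  · rw [hsd]
    linarith
  · have h8 : c ≤ a := by
      have : 0 ≤ (y - 2 * δ) / (γ - 1) := div_nonneg (by linarith) hγ.le
      linarith
    by_contra hcon
    have h9 := mul_le_mul_of_nonneg_left h8 hγ.le
    have h10 := mul_le_mul_of_nonneg_left (not_lt.1 hcon) hγ0.le
    linarith
  · have h11 : γ * α * (σ - d) = γ * (α * σ) - γ * c := by rw [hc]; ring
    rw [h11]
    linarith

/-- Here all branching goes into space (`θ = 0`) and `γ` is taken large: then `a` is close to `1`,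
and `α * σ` can approach `1`. The shifts `1`, `2`, `3` of `β` leave slack between successive
constraints. -/
theorem exists_exponents_of_one_le {σ : ℝ} (hα : 0 < α) (hβ : 1 < β) (hαd : 1 ≤ α * d)
    (hσ0 : 0 < σ) (hσ : σ < 1 / α) :
    ∃ γ s θ a : ℝ, 1 < γ ∧ 0 < s ∧ 0 ≤ θ ∧ β + θ + s * d < γ ∧ a * (γ - 1) < s * d + θ ∧
      γ * α * σ < a + s * d ∧ α * σ < a ∧ α * d + γ * α * (σ - d) < a := by
  have hd : 0 < d := pos_of_mul_pos_right (by linarith) hα.le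
  set η := α * σ with hη
  have hη0 : 0 < η := by positivity
  have hη1 : η < 1 := by
    rw [lt_div_iff₀ hα] at hσ
    linarith
  set γ := (β + 3) / (1 - η) with hγdef
  have hγ : γ * (1 - η) = β + 3 := div_mul_cancel₀ _ (by linarith)
  have hγ3 : β + 3 < γ := by
    rw [hγdef, lt_div_iff₀ (by linarith)]
    nlinarith
  have hγ1 : 0 < γ - 1 := by linarith
  have hsd : (γ - β - 1) / d * d = γ - β - 1 := div_mul_cancel₀ _ hd.ne'
  set a := (γ - β - 2) / (γ - 1) with ha
  have haγ : a * (γ - 1) = γ - β - 2 := div_mul_cancel₀ _ hγ1.ne'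
  have ha0 : 0 < a := div_pos (by linarith) hγ1
  have hγη : γ * α * σ = γ - (β + 3) := by
    rw [mul_assoc, ← hη]
    linarith
  refine ⟨γ, (γ - β - 1) / d, 0, a, by linarith, div_pos (by linarith) hd, le_rfl, ?_, ?_, ?_, ?_,
    ?_⟩
  · rw [hsd]
    linarith
  · rw [hsd, haγ]
    linarith
  · rw [hsd, hγη]
    linarith
  · rw [ha, lt_div_iff₀ hγ1]
    linarith
  · have h1 : γ * α * (σ - d) = γ * α * σ - γ * (α * d) := by ring
    rw [h1, hγη]
    nlinarith

end Exponents

theorem ae_ofReal_le_of_forall_lt {Ω : Type*} [MeasurableSpace Ω] {P : Measure Ω}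
    {v : ℝ} {f : Ω → ℝ≥0∞}
    (h : ∀ σ, 0 < σ → σ < v → ∀ᵐ ω ∂P, ENNReal.ofReal σ ≤ f ω) :
    ∀ᵐ ω ∂P, ENNReal.ofReal v ≤ f ω := by
  rcases le_or_gt v 0 with hv | hv
  · filter_upwards with ω
    rw [ENNReal.ofReal_of_nonpos hv]
    exact zero_le
  obtain ⟨s, -, hs, hlim⟩ := exists_seq_strictMono_tendsto' hv
  have h1 : ∀ᵐ ω ∂P, ∀ n, ENNReal.ofReal (s n) ≤ f ω :=
    ae_all_iff.2 fun n => h (s n) (hs n).1 (hs n).2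
  filter_upwards [h1] with ω hω
  exact le_of_tendsto' (ENNReal.tendsto_ofReal hlim) hω

end Gluing

theorem mainTheorem4
    {U : Type*} [MetricSpace U] [CompleteSpace U] [SecondCountableTopology U]
    [MeasurableSpace U] [BorelSpace U] (u₀ : U)
    {Ω : Type*} [MeasurableSpace Ω] (P : Measure Ω) [IsProbabilityMeasure P]
    (α β d : ℝ) (hd : 0 ≤ d)
    (lam w : ℕ → ℝ) (hlam : ∀ n, 0 < lam n) (hw : ∀ n ≥ 1, 0 ≤ w n) (hw₁ : 0 < w 1)
    (hdiamond : Gluing.HypDiamond α β lam w)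
    (τ : Measure (Gluing.Block U u₀)) (hτ : Gluing.HypH d τ)
    (B : ℕ → Ω → Gluing.Block U u₀) (K : ℕ → Ω → ℕ) (X : ℕ → Ω → U)
    (hglue : Gluing.IsGluingProcess P τ w B K X) :
    -- the condition `α * d < 1` reads `α < 1 / d`, with `1 / d = ∞` when `d = 0`
    (α * d < 1 → ∀ᵐ ω ∂P,
      ENNReal.ofReal ((2 * β - 1 - 2 * √((β - 1) * (β - α * d))) / α) ≤
        dimH (Gluing.leaves hlam (fun n => B n ω) (fun n => K n ω) (fun n => X n ω))) ∧
    (1 ≤ α * d → ∀ᵐ ω ∂P,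
      ENNReal.ofReal (1 / α) ≤
        dimH (Gluing.leaves hlam (fun n => B n ω) (fun n => K n ω) (fun n => X n ω))) := by
  refine ⟨fun hαd => Gluing.ae_ofReal_le_of_forall_lt fun σ hσ0 hσ => ?_,
    fun hαd => Gluing.ae_ofReal_le_of_forall_lt fun σ hσ0 hσ => ?_⟩
  · obtain ⟨γ, s, θ, a, hγ, hs, hθ, h1, h2, h3, h4, h5⟩ := Gluing.exists_exponents_of_lt_one
      hdiamond.alpha_pos hdiamond.one_lt_beta hd hαd hσ
    exact hglue.ae_ofReal_le_dimH hd hlam hw hw₁ hdiamond hτ hγ hs hθ hσ0 h1 h2 h3 h4 h5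
  · obtain ⟨γ, s, θ, a, hγ, hs, hθ, h1, h2, h3, h4, h5⟩ := Gluing.exists_exponents_of_one_le
      hdiamond.alpha_pos hdiamond.one_lt_beta hαd hσ0 hσ
    exact hglue.ae_ofReal_le_dimH hd hlam hw hw₁ hdiamond hτ hγ hs hθ hσ0 h1 h2 h3 h4 h5
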